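/- **Proposition.** Identify the vertices of the infinite rooted binary tree with the finite binary sequences $v\in\{0,1\}^*$, where $v0$ and $v1$ are the left and the right child of $v$. Let $QV$ be the group, under composition, of all bijections $h:\{0,1\}^*\to\{0,1\}^*$ such that $h(v0)=h(v)0$ and $h(v1)=h(v)1$ for all but finitely many $v$. Let $\mathcal P=\langle x,a\mid x=xax\rangle$. A braided $(x,x)$-diagram over $\mathcal P$ consists of a frame with one contact, labelled $x$, on its top and one on its bottom, of finitely many transistors, each of which is either *positive* (top label $x$, bottom label $xax$) or *negative* (top label $xax$, bottom label $x$), and of wires labelled $x$ or $a$. The upper end of each wire is attached to the top of the frame or to the bottom of a transistor, its lower end to the bottom of the frame or to the top of a transistor; each contact belongs to exactly one wire, whose label is the letter at the contact; and the relation "some wire has its lower end on the top of $T_1$ and its upper end on the bottom of $T_2$" generates a strict partial order on the transistors. Diagrams are considered up to label- and order-preserving isomorphism. Two transistors $T_1,T_2$ form a dipole if the wires at the top of $T_1$ are exactly the wires at the bottom of $T_2$, in the same left-to-right order, and the top label of $T_2$ equals the bottom label of $T_1$; the dipole is removed by deleting $T_1$, $T_2$ and the wires between them and joining, in left-to-right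 order, the wires at the top of $T_2$ to the wires at the bottom of $T_1$. The braided diagram group $D_b(\mathcal P,x)$ is the set of braided $(x,x)$-diagrams modulo the equivalence relation generated by isomorphism and dipole removal, with the product induced by the concatenation $\Delta'\circ\Delta''$ ($\Delta'$ stacked on top of $\Delta''$). There is a group isomorphism $D_b(\mathcal P,x)\to QV$ that sends the class of every braided $(x,x)$-diagram $\Delta$ to the bijection $f_\Delta$ determined by $\Delta$ as follows. Each $x$-wire carries an infinite binary tree, with vertex set $\{0,1\}^*$, and each $a$-wire carries a single vertex. Start with a vertex $s$ of the tree carried by the wire attached to the bottom of the frame and follow it upwards. A negative transistor dissects the tree on its bottom wire into two trees and a vertex: the root goes to the $a$-wire, $0s'$ goes to the vertex $s'$ on the left $x$-wire, and $1s'$ to the vertex $s'$ on the right $x$-wire. A positive transistor assembles two trees and a vertex into the tree on its top wire: the vertex on the $a$-wire becomes the root, the vertex $s'$ on the left $x$-wire becomes $0s'$, and the vertex $s'$ on the right $x$-wire becomes $1s'$. The vertex at which one arrives on the wire attached to the top of the frame is $f_\Delta(s)$. -/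

import Mathlib

/-- A semigroup presentation `⟨α | rels⟩`: the relations are pairs of distinct non-empty
words in the alphabet `α`. -/
structure SemigroupPresentation (α : Type*) where
  rels : Set (List α × List α)
  left_ne_nil : ∀ r ∈ rels, r.1 ≠ []
  right_ne_nil : ∀ r ∈ rels, r.2 ≠ []
  ne : ∀ r ∈ rels, r.1 ≠ r.2

/-- The contacts on one horizontal level of a diagram: one for each letter of the word `w`
(read on the top or on the bottom of the frame), and one for each letter of the word `lab t`
(read on the bottom or on the top of the transistor `t`), for each `t : T`.
Positions are counted from left to right. -/
abbrev Contacts {α T : Type*} (w : List α) (lab : T → List α) : Type _ :=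
  Fin w.length ⊕ (Σ t : T, Fin (lab t).length)

/-- The letter written at a contact. -/
def contactLabel {α T : Type*} (w : List α) (lab : T → List α) : Contacts w lab → α
  | .inl i => w.get i
  | .inr p => (lab p.1).get p.2

/-- A map of transistors which preserves the labels induces a map of contacts; it fixes the
contacts on the frame and preserves the left-to-right position of contacts on transistors. -/
def mapContacts {α T T' : Type*} (w : List α) {lab : T → List α} {lab' : T' → List α}
    (f : T → T') (h : ∀ t, lab' (f t) = lab t) : Contacts w lab → Contacts w lab'
  | .inl i => .inl i
  | .inr p => .inr ⟨f p.1, p.2.cast (congrArg List.length (h p.1).symm)⟩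

/-- Braided `(u, v)`-diagrams over `P`, as combinatorial objects: `T` is the finite set of
transistors, `top t` and `bot t` are the labels of the top and of the bottom side of `t`.
The *upper ends* of the wires are attached to the top of the frame (labelled `u`) and to the
bottoms of the transistors; their *lower ends* are attached to the bottom of the frame
(labelled `v`) and to the tops of the transistors. Every contact lies on exactly one wire, so the
set of wires is the graph of a bijection `wire`, sending the upper end of each wire to its
lower end; as a wire has one label, `wire` preserves labels. -/
structure BraidedDiagram {α : Type*} (P : SemigroupPresentation α) (u v : List α) where
  T : Type
  finite_T : Finite T
  top : T → List α
  bot : T → List α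
  rel_mem : ∀ t, (top t, bot t) ∈ P.rels ∨ (bot t, top t) ∈ P.rels
  wire : Contacts u bot ≃ Contacts v top
  wire_label : ∀ c, contactLabel v top (wire c) = contactLabel u bot c
  /-- Say that `t` is directly below `s` if some wire has its lower end on the top of `t` and its
  upper end on the bottom of `s`. The transitive closure of this relation is irreflexive, that is,
  it is a strict partial order. -/
  acyclic : ∀ t, ¬ Relation.TransGen
    (fun t s => ∃ j k, wire (.inr ⟨s, j⟩) = .inr ⟨t, k⟩) t t

namespace BraidedDiagram

variable {α : Type*} {P : SemigroupPresentation α} {u v w : List α}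

/-- Equivalence of diagrams: a bijection between the transistors that preserves all labels and
all attachments, with the left-to-right orders. -/
def Iso (D D' : BraidedDiagram P u v) : Prop :=
  ∃ (e : D.T ≃ D'.T) (htop : ∀ t, D'.top (e t) = D.top t) (hbot : ∀ t, D'.bot (e t) = D.bot t),
    ∀ c, D'.wire (mapContacts u e hbot c) = mapContacts v e htop (D.wire c)

/-- The transistors `t₁` and `t₂` form a dipole: the wires attached to the top of `t₁` are
attached, in the same left-to-right order, to the bottom of `t₂`, no other wires are attached to
the bottom of `t₂`, and the top label of `t₂` is the bottom label of `t₁`. -/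
structure IsDipole (D : BraidedDiagram P u v) (t₁ t₂ : D.T) : Prop where
  length_eq : (D.top t₁).length = (D.bot t₂).length
  wire_eq : ∀ i : Fin (D.top t₁).length,
    D.wire (.inr ⟨t₂, i.cast length_eq⟩) = .inr ⟨t₁, i⟩
  label_eq : D.top t₂ = D.bot t₁

/-- `D'` is (up to equivalence of diagrams) the result of removing a dipole `t₁, t₂` from `D`:
the transistors of `D'` are those of `D` other than `t₁, t₂`; a wire of `D` that goes down to
the `k`-th contact on the top of `t₂` is continued by the wire of `D` that starts at
the `k`-th contact on the bottom of `t₁`; all other remaining wires are kept. -/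
def RemovesDipole (D D' : BraidedDiagram P u v) : Prop :=
  ∃ (t₁ t₂ : D.T) (h : D.IsDipole t₁ t₂) (f : D'.T → D.T)
    (htop : ∀ t, D.top (f t) = D'.top t) (hbot : ∀ t, D.bot (f t) = D'.bot t),
    Function.Injective f ∧ Set.range f = {t | t ≠ t₁ ∧ t ≠ t₂} ∧
    ∀ c : Contacts u D'.bot,
      (∀ k, D.wire (mapContacts u f hbot c) = .inr ⟨t₂, k⟩ →
        mapContacts v f htop (D'.wire c) =
          D.wire (.inr ⟨t₁, k.cast (congrArg List.length h.label_eq)⟩)) ∧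
      ((∀ k, D.wire (mapContacts u f hbot c) ≠ .inr ⟨t₂, k⟩) →
        mapContacts v f htop (D'.wire c) = D.wire (mapContacts u f hbot c))

/-- The equivalence relation generated by equivalence of diagrams and removal of dipoles. -/
def dipoleSetoid (P : SemigroupPresentation α) (u v : List α) : Setoid (BraidedDiagram P u v) :=
  Relation.EqvGen.setoid (fun D D' => Iso D D' ∨ RemovesDipole D D')

section concat

variable (D : BraidedDiagram P u v) (E : BraidedDiagram P v w)

/-- Lower contacts of the lower diagram `E`, seen in the concatenation `D ∘ E`. -/
def lowerOfLower : Contacts w E.top → Contacts w (Sum.elim D.top E.top)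
  | .inl k => .inl k
  | .inr ⟨t, j⟩ => .inr ⟨.inr t, j⟩

/-- Where a wire of the upper diagram `D` ends in the concatenation `D ∘ E`, if in `D` it ends at
the given lower contact: a wire that ends at the `k`-th contact on the bottom of the frame of
`D` is continued by the wire of `E` that starts at the `k`-th contact on the top of its frame. -/
def lowerOfUpper : Contacts v D.top → Contacts w (Sum.elim D.top E.top)
  | .inl k => lowerOfLower D E (E.wire (.inl k))
  | .inr ⟨t, j⟩ => .inr ⟨.inl t, j⟩

/-- Upper contacts of the upper diagram `D`, seen in the concatenation `D ∘ E`. -/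
def upperOfUpper : Contacts u D.bot → Contacts u (Sum.elim D.bot E.bot)
  | .inl k => .inl k
  | .inr ⟨t, j⟩ => .inr ⟨.inl t, j⟩

/-- Where a wire of the lower diagram `E` starts in the concatenation `D ∘ E`, if in `E` it starts
at the given upper contact. -/
def upperOfLower : Contacts v E.bot → Contacts u (Sum.elim D.bot E.bot)
  | .inl k => upperOfUpper D E (D.wire.symm (.inl k))
  | .inr ⟨t, j⟩ => .inr ⟨.inr t, j⟩

/-- The wires of the concatenation `D ∘ E`. -/
def concatWire : Contacts u (Sum.elim D.bot E.bot) → Contacts w (Sum.elim D.top E.top)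
  | .inl i => lowerOfUpper D E (D.wire (.inl i))
  | .inr ⟨.inl t, j⟩ => lowerOfUpper D E (D.wire (.inr ⟨t, j⟩))
  | .inr ⟨.inr t, j⟩ => lowerOfLower D E (E.wire (.inr ⟨t, j⟩))

/-- The inverse of `concatWire`: going up along the wires of the concatenation `D ∘ E`. -/
def concatWireInv : Contacts w (Sum.elim D.top E.top) → Contacts u (Sum.elim D.bot E.bot)
  | .inl i => upperOfLower D E (E.wire.symm (.inl i))
  | .inr ⟨.inr t, j⟩ => upperOfLower D E (E.wire.symm (.inr ⟨t, j⟩))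
  | .inr ⟨.inl t, j⟩ => upperOfUpper D E (D.wire.symm (.inr ⟨t, j⟩))

theorem concatWire_upperOfUpper (c : Contacts u D.bot) :
    concatWire D E (upperOfUpper D E c) = lowerOfUpper D E (D.wire c) := by
  rcases c with i | ⟨t, j⟩ <;> rfl

theorem concatWire_upperOfLower (c : Contacts v E.bot) :
    concatWire D E (upperOfLower D E c) = lowerOfLower D E (E.wire c) := by
  rcases c with i | ⟨t, j⟩
  · simp only [upperOfLower, concatWire_upperOfUpper, Equiv.apply_symm_apply]; rfl
  · rfl

theorem concatWireInv_lowerOfLower (c : Contacts w E.top) :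
    concatWireInv D E (lowerOfLower D E c) = upperOfLower D E (E.wire.symm c) := by
  rcases c with i | ⟨t, j⟩ <;> rfl

theorem concatWireInv_lowerOfUpper (c : Contacts v D.top) :
    concatWireInv D E (lowerOfUpper D E c) = upperOfUpper D E (D.wire.symm c) := by
  rcases c with i | ⟨t, j⟩
  · simp only [lowerOfUpper, concatWireInv_lowerOfLower, Equiv.symm_apply_apply]; rfl
  · rfl

theorem label_lowerOfLower (c : Contacts w E.top) :
    contactLabel w (Sum.elim D.top E.top) (lowerOfLower D E c) = contactLabel w E.top c := by
  rcases c with i | ⟨t, j⟩ <;> rfl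

theorem label_lowerOfUpper (c : Contacts v D.top) :
    contactLabel w (Sum.elim D.top E.top) (lowerOfUpper D E c) = contactLabel v D.top c := by
  rcases c with i | ⟨t, j⟩
  · simp only [lowerOfUpper, label_lowerOfLower, E.wire_label]; rfl
  · rfl

theorem lowerOfLower_ne (c : Contacts w E.top) (t : D.T) (j) :
    lowerOfLower D E c ≠ .inr ⟨.inl t, j⟩ := by
  rcases c with i | ⟨s, k⟩ <;> intro h
  · cases h
  · cases Sum.inr.inj h

theorem lowerOfLower_injective : Function.Injective (lowerOfLower D E) := by
  rintro (i | ⟨t, j⟩) (i' | ⟨t', j'⟩) h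
  · cases h; rfl
  · cases h
  · cases h
  · cases Sum.inr.inj h; rfl

theorem lowerOfUpper_eq {c : Contacts v D.top} {t : D.T} {j : Fin (D.top t).length}
    (h : lowerOfUpper D E c = .inr ⟨.inl t, j⟩) : c = .inr ⟨t, j⟩ := by
  rcases c with i | ⟨s, k⟩
  · exact absurd h (lowerOfLower_ne D E _ _ _)
  · cases Sum.inr.inj h; rfl

/-- The concatenation `D ∘ E`: the diagram `D` stacked on top of the diagram `E`, the bottom of the
frame of `D` being glued to the top of the frame of `E`. -/
def concat : BraidedDiagram P u w where
  T := D.T ⊕ E.T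
  finite_T := by
    have := D.finite_T
    have := E.finite_T
    infer_instance
  top := Sum.elim D.top E.top
  bot := Sum.elim D.bot E.bot
  rel_mem := by
    rintro (t | t)
    · exact D.rel_mem t
    · exact E.rel_mem t
  wire :=
    { toFun := concatWire D E
      invFun := concatWireInv D E
      left_inv := by
        rintro (i | ⟨t | t, j⟩)
        · simp only [concatWire, concatWireInv_lowerOfUpper, Equiv.symm_apply_apply]; rfl
        · simp only [concatWire, concatWireInv_lowerOfUpper, Equiv.symm_apply_apply]; rfl
        · simp only [concatWire, concatWireInv_lowerOfLower, Equiv.symm_apply_apply]; rfl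
      right_inv := by
        rintro (i | ⟨t | t, j⟩)
        · simp only [concatWireInv, concatWire_upperOfLower, Equiv.apply_symm_apply]; rfl
        · simp only [concatWireInv, concatWire_upperOfUpper, Equiv.apply_symm_apply]; rfl
        · simp only [concatWireInv, concatWire_upperOfLower, Equiv.apply_symm_apply]; rfl }
  wire_label := by
    rintro (i | ⟨t | t, j⟩)
    · exact (label_lowerOfUpper D E _).trans (D.wire_label _)
    · exact (label_lowerOfUpper D E _).trans (D.wire_label _)
    · exact (label_lowerOfLower D E _).trans (E.wire_label _)
  acyclic := by
    have step : ∀ t s : D.T ⊕ E.T, Relation.TransGen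
        (fun t s => ∃ (j : Fin (Sum.elim D.bot E.bot s).length)
          (k : Fin (Sum.elim D.top E.top t).length),
          concatWire D E (.inr ⟨s, j⟩) = .inr ⟨t, k⟩) t s →
        Sum.Lex (Relation.TransGen fun t s => ∃ j k, E.wire (.inr ⟨s, j⟩) = .inr ⟨t, k⟩)
          (Relation.TransGen fun t s => ∃ j k, D.wire (.inr ⟨s, j⟩) = .inr ⟨t, k⟩)
          t.swap s.swap := by
      have one : ∀ t s : D.T ⊕ E.T, (∃ (j : Fin (Sum.elim D.bot E.bot s).length)
          (k : Fin (Sum.elim D.top E.top t).length),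
          concatWire D E (.inr ⟨s, j⟩) = .inr ⟨t, k⟩) →
          Sum.Lex (Relation.TransGen fun t s => ∃ j k, E.wire (.inr ⟨s, j⟩) = .inr ⟨t, k⟩)
          (Relation.TransGen fun t s => ∃ j k, D.wire (.inr ⟨s, j⟩) = .inr ⟨t, k⟩)
          t.swap s.swap := by
        rintro (t | t) (s | s) ⟨j, k, h⟩
        · exact .inr (.single ⟨j, k, lowerOfUpper_eq D E h⟩)
        · exact absurd h (lowerOfLower_ne D E _ _ _)
        · exact .sep _ _
        · exact .inl (.single ⟨j, k, lowerOfLower_injective D E h⟩)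
      intro t s h
      induction h with
      | single h => exact one _ _ h
      | tail _ h ih => exact _root_.trans ih (one _ _ h)
    rintro (t | t) h
    · exact D.acyclic t (Sum.lex_inr_inr.1 (step _ _ h))
    · exact E.acyclic t (Sum.lex_inl_inl.1 (step _ _ h))

end concat
/-! Concatenation is compatible with the equivalence relation. -/

section congr

variable {D D' : BraidedDiagram P u v} {E E' : BraidedDiagram P v w}

theorem elim_map {S T S' T' : Type} {a : S → List α} {b : T → List α} {a' : S' → List α}
    {b' : T' → List α} {f : S → S'} {g : T → T'} (hf : ∀ t, a' (f t) = a t)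
    (hg : ∀ t, b' (g t) = b t) (t : S ⊕ T) :
    Sum.elim a' b' (Sum.map f g t) = Sum.elim a b t := by
  rcases t with t | t
  · exact hf t
  · exact hg t

theorem map_lowerOfLower {f : D'.T → D.T} {g : E'.T → E.T} (hf : ∀ t, D.top (f t) = D'.top t)
    (hg : ∀ t, E.top (g t) = E'.top t) (c : Contacts w E'.top) :
    mapContacts w (Sum.map f g) (elim_map hf hg) (lowerOfLower D' E' c) =
      lowerOfLower D E (mapContacts w g hg c) := by
  rcases c with i | ⟨t, j⟩ <;> rfl

theorem map_upperOfUpper {f : D'.T → D.T} {g : E'.T → E.T} (hf : ∀ t, D.bot (f t) = D'.bot t)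
    (hg : ∀ t, E.bot (g t) = E'.bot t) (c : Contacts u D'.bot) :
    mapContacts u (Sum.map f g) (elim_map hf hg) (upperOfUpper D' E' c) =
      upperOfUpper D E (mapContacts u f hf c) := by
  rcases c with i | ⟨t, j⟩ <;> rfl

theorem concat_cases {p : Contacts u (Sum.elim D.bot E.bot) → Prop}
    (h₁ : ∀ c, p (upperOfUpper D E c)) (h₂ : ∀ t j, p (.inr ⟨.inr t, j⟩)) (c) : p c := by
  rcases c with i | ⟨t | t, j⟩
  · exact h₁ (.inl i)
  · exact h₁ (.inr ⟨t, j⟩)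
  · exact h₂ t j

theorem Iso.concat (h₁ : Iso D D') (h₂ : Iso E E') : Iso (D.concat E) (D'.concat E') := by
  obtain ⟨e, ht, hb, he⟩ := h₁
  obtain ⟨e', ht', hb', he'⟩ := h₂
  refine ⟨Equiv.sumCongr e e', elim_map ht ht', elim_map hb hb', fun c => ?_⟩
  change concatWire D' E' (mapContacts u (Sum.map e e') (elim_map hb hb') c) =
    mapContacts w (Sum.map e e') (elim_map ht ht') (concatWire D E c)
  induction c using concat_cases with
  | h₁ c =>
    rw [map_upperOfUpper hb hb', concatWire_upperOfUpper, concatWire_upperOfUpper, he]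
    rcases D.wire c with i | ⟨t, j⟩
    · exact (congrArg _ (he' (.inl i))).trans (map_lowerOfLower ht ht' _).symm
    · rfl
  | h₂ t j => exact (congrArg _ (he' (.inr ⟨t, j⟩))).trans (map_lowerOfLower ht ht' _).symm

theorem range_map_id {S S' T : Type} {f : S' → S} {t₁ t₂ : S}
    (hr : Set.range f = {t | t ≠ t₁ ∧ t ≠ t₂}) :
    Set.range (Sum.map f (id : T → T)) = {t | t ≠ .inl t₁ ∧ t ≠ .inl t₂} := by
  ext (t | t)
  · simpa using Set.ext_iff.1 hr t
  · simp

theorem range_id_map {S S' T : Type} {f : S' → S} {t₁ t₂ : S}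
    (hr : Set.range f = {t | t ≠ t₁ ∧ t ≠ t₂}) :
    Set.range (Sum.map (id : T → T) f) = {t | t ≠ .inr t₁ ∧ t ≠ .inr t₂} := by
  ext (t | t)
  · simp
  · simpa using Set.ext_iff.1 hr t

theorem RemovesDipole.concat_right (h : RemovesDipole D D') (E : BraidedDiagram P v w) :
    RemovesDipole (D.concat E) (D'.concat E) := by
  obtain ⟨t₁, t₂, hd, f, ht, hb, hf, hr, hw⟩ := h
  have ht' : ∀ t, E.top (id t) = E.top t := fun _ => rfl
  have hb' : ∀ t, E.bot (id t) = E.bot t := fun _ => rfl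
  refine ⟨.inl t₁, .inl t₂, ⟨hd.length_eq, fun i => ?_, hd.label_eq⟩, Sum.map f id,
    elim_map ht ht', elim_map hb hb', hf.sumMap Function.injective_id, range_map_id hr, fun c => ?_⟩
  · exact congrArg (lowerOfUpper D E) (hd.wire_eq i)
  have key : ∀ c' : Contacts v D'.top,
      mapContacts w (Sum.map f id) (elim_map ht ht') (lowerOfUpper D' E c') =
        lowerOfUpper D E (mapContacts v f ht c') := by
    rintro (i | ⟨t, j⟩)
    · refine (map_lowerOfLower (E := E) ht ht' _).trans ?_
      change lowerOfLower D E _ = lowerOfLower D E (E.wire (.inl i))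
      rcases E.wire (.inl i) with _ | _ <;> rfl
    · rfl
  change (∀ k : Fin (D.top t₂).length, concatWire D E (mapContacts u (Sum.map f id) (elim_map hb hb') c) =
        .inr ⟨.inl t₂, k⟩ →
      mapContacts w (Sum.map f id) (elim_map ht ht') (concatWire D' E c) = concatWire D E
        (.inr ⟨.inl t₁, k.cast (congrArg List.length hd.label_eq)⟩)) ∧
    ((∀ k : Fin (D.top t₂).length, concatWire D E (mapContacts u (Sum.map f id) (elim_map hb hb') c) ≠
        .inr ⟨.inl t₂, k⟩) →
      mapContacts w (Sum.map f id) (elim_map ht ht') (concatWire D' E c) =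
        concatWire D E (mapContacts u (Sum.map f id) (elim_map hb hb') c))
  induction c using concat_cases with
  | h₁ c =>
    rw [map_upperOfUpper (E := E) hb hb', concatWire_upperOfUpper, concatWire_upperOfUpper, key]
    refine ⟨fun k hk => ?_, fun hk => ?_⟩
    · exact congrArg (lowerOfUpper D E) ((hw c).1 k (lowerOfUpper_eq D E hk))
    · refine congrArg (lowerOfUpper D E) ((hw c).2 fun k hk' => hk k ?_)
      rw [hk']; rfl
  | h₂ t j =>
    refine ⟨fun k hk => absurd hk (lowerOfLower_ne D E _ _ _), fun _ => ?_⟩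
    refine (map_lowerOfLower (E := E) ht ht' _).trans ?_
    change lowerOfLower D E _ = lowerOfLower D E (E.wire (.inr ⟨t, j⟩))
    rcases E.wire (.inr ⟨t, j⟩) with _ | _ <;> rfl

theorem lowerOfUpper_eq' {D : BraidedDiagram P u v} {E : BraidedDiagram P v w}
    {c : Contacts v D.top} {t : E.T} {j : Fin (E.top t).length}
    (h : lowerOfUpper D E c = .inr ⟨.inr t, j⟩) :
    ∃ i, c = .inl i ∧ E.wire (.inl i) = .inr ⟨t, j⟩ := by
  rcases c with i | ⟨s, k⟩
  · exact ⟨i, rfl, lowerOfLower_injective D E h⟩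
  · cases Sum.inr.inj h

theorem RemovesDipole.concat_left (D : BraidedDiagram P u v) (h : RemovesDipole E E') :
    RemovesDipole (D.concat E) (D.concat E') := by
  obtain ⟨t₁, t₂, hd, f, ht, hb, hf, hr, hw⟩ := h
  have ht' : ∀ t, D.top (id t) = D.top t := fun _ => rfl
  have hb' : ∀ t, D.bot (id t) = D.bot t := fun _ => rfl
  refine ⟨.inr t₁, .inr t₂, ⟨hd.length_eq, fun i => ?_, hd.label_eq⟩, Sum.map id f,
    elim_map ht' ht, elim_map hb' hb, Function.injective_id.sumMap hf, range_id_map hr, fun c => ?_⟩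
  · exact congrArg (lowerOfLower D E) (hd.wire_eq i)
  change (∀ k : Fin (E.top t₂).length, concatWire D E (mapContacts u (Sum.map id f) (elim_map hb' hb) c) =
        .inr ⟨.inr t₂, k⟩ →
      mapContacts w (Sum.map id f) (elim_map ht' ht) (concatWire D E' c) = concatWire D E
        (.inr ⟨.inr t₁, k.cast (congrArg List.length hd.label_eq)⟩)) ∧
    ((∀ k : Fin (E.top t₂).length, concatWire D E (mapContacts u (Sum.map id f) (elim_map hb' hb) c) ≠
        .inr ⟨.inr t₂, k⟩) →
      mapContacts w (Sum.map id f) (elim_map ht' ht) (concatWire D E' c) =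
        concatWire D E (mapContacts u (Sum.map id f) (elim_map hb' hb) c))
  induction c using concat_cases with
  | h₁ c =>
    rw [map_upperOfUpper (D := D) hb' hb, concatWire_upperOfUpper, concatWire_upperOfUpper,
      show mapContacts u id hb' c = c by rcases c with _ | _ <;> rfl]
    rcases D.wire c with i | ⟨t, j⟩
    · refine ⟨fun k hk => ?_, fun hk => ?_⟩
      · exact (map_lowerOfLower (D := D) ht' ht _).trans (congrArg (lowerOfLower D E)
          ((hw (.inl i)).1 k (lowerOfLower_injective D E hk)))
      · refine (map_lowerOfLower (D := D) ht' ht _).trans (congrArg (lowerOfLower D E)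
          ((hw (.inl i)).2 fun k hk' => hk k ?_))
        exact congrArg (lowerOfLower D E) hk'
    · exact ⟨fun k hk => (by cases Sum.inr.inj hk), fun _ => rfl⟩
  | h₂ t j =>
    refine ⟨fun k hk => ?_, fun hk => ?_⟩
    · exact (map_lowerOfLower (D := D) ht' ht _).trans (congrArg (lowerOfLower D E)
        ((hw (.inr ⟨t, j⟩)).1 k (lowerOfLower_injective D E hk)))
    · refine (map_lowerOfLower (D := D) ht' ht _).trans (congrArg (lowerOfLower D E)
        ((hw (.inr ⟨t, j⟩)).2 fun k hk' => hk k ?_))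
      exact congrArg (lowerOfLower D E) hk'

theorem Iso.refl (D : BraidedDiagram P u v) : Iso D D := by
  refine ⟨Equiv.refl _, fun _ => rfl, fun _ => rfl, fun c => ?_⟩
  have h₁ : ∀ h : ∀ t, D.bot (id t) = D.bot t, mapContacts u id h c = c := by
    rcases c with _ | _ <;> exact fun _ => rfl
  have h₂ : ∀ (h : ∀ t, D.top (id t) = D.top t) (c), mapContacts v id h c = c := by
    rintro h (_ | _) <;> rfl
  exact (congrArg D.wire (h₁ _)).trans (h₂ _ _).symm

theorem concat_congr (h₁ : dipoleSetoid P u v D D') (h₂ : dipoleSetoid P v w E E') :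
    dipoleSetoid P u w (D.concat E) (D'.concat E') := by
  have h₁' : dipoleSetoid P u w (D.concat E) (D'.concat E) := by
    induction h₁ with
    | rel _ _ h => exact .rel _ _ (h.imp (·.concat (Iso.refl E)) (·.concat_right E))
    | refl => exact .refl _
    | symm _ _ _ ih => exact .symm _ _ ih
    | trans _ _ _ _ _ ih ih' => exact .trans _ _ _ ih ih'
  refine Setoid.trans' _ h₁' ?_
  clear h₁'
  induction h₂ with
  | rel _ _ h => exact .rel _ _ (h.imp ((Iso.refl D').concat ·) (·.concat_left D'))
  | refl => exact .refl _
  | symm _ _ _ ih => exact .symm _ _ ih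
  | trans _ _ _ _ _ ih ih' => exact .trans _ _ _ ih ih'

end congr
end BraidedDiagram

/-- The braided diagram group `D_b(P, w)`: the braided `(w, w)`-diagrams over `P` modulo dipoles,
with the multiplication induced by concatenation. -/
def BraidedDiagramGroup {α : Type*} (P : SemigroupPresentation α) (w : List α) : Type _ :=
  Quotient (BraidedDiagram.dipoleSetoid P w w)

namespace BraidedDiagramGroup

variable {α : Type*} {P : SemigroupPresentation α} {w : List α}

/-- The class of a diagram modulo dipoles. -/
def mk (D : BraidedDiagram P w w) : BraidedDiagramGroup P w :=
  Quotient.mk _ D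

instance : Mul (BraidedDiagramGroup P w) where
  mul := Quotient.map₂ BraidedDiagram.concat
    fun _ _ h₁ _ _ h₂ => BraidedDiagram.concat_congr h₁ h₂

theorem mk_mul_mk (D E : BraidedDiagram P w w) : mk D * mk E = mk (D.concat E) := rfl

end BraidedDiagramGroup

/-- The alphabet `{x, a}`. -/
inductive TreeLetter
  | x
  | a

/-- The semigroup presentation `⟨x, a | x = xax⟩`. -/
def treePresentation : SemigroupPresentation TreeLetter where
  rels := {([.x], [.x, .a, .x])}
  left_ne_nil := by simp
  right_ne_nil := by simp
  ne := by simp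

/-- The group `QV`. The vertices of the infinite rooted binary tree are the finite binary sequences;
the left and the right child of `v` are `v ++ [false]` and `v ++ [true]`. A bijection `h` of
the vertices is in `QV` if, for all but finitely many `v`, it sends the left child of `v` to the
left child of `h v` and the right child of `v` to the right child of `h v`. -/
def QV : Subgroup (Equiv.Perm (List Bool)) where
  carrier := {h | {v | ¬ (h (v ++ [false]) = h v ++ [false] ∧
    h (v ++ [true]) = h v ++ [true])}.Finite}
  one_mem' := by simp
  mul_mem' := by
    intro g h hg hh
    refine (hh.union (hg.preimage h.injective.injOn)).subset fun v hv => ?_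
    by_contra hc
    simp only [Set.mem_union, Set.mem_preimage, Set.mem_ofPred_eq, not_or, not_not] at hc
    refine hv ⟨?_, ?_⟩
    · rw [Equiv.Perm.mul_apply, hc.1.1, hc.2.1, Equiv.Perm.mul_apply]
    · rw [Equiv.Perm.mul_apply, hc.1.2, hc.2.2, Equiv.Perm.mul_apply]
  inv_mem' := by
    intro h hh
    refine (hh.preimage (f := h.symm) h.symm.injective.injOn).subset fun v hv => ?_
    by_contra hc
    simp only [Set.mem_preimage, Set.mem_ofPred_eq, not_not, Equiv.apply_symm_apply] at hc
    exact hv ⟨(h.symm_apply_eq).2 hc.1.symm, (h.symm_apply_eq).2 hc.2.symm⟩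

/-- How a transistor transports vertices from bottom to top. An `x`-wire carries an infinite binary
tree with vertices `s : List Bool`, an `a`-wire carries a single vertex, denoted `[]`.
`Transports bot top j s k s'` says that, for a transistor with bottom label `bot` and top label
`top`, the vertex `s` carried by the wire at the `j`-th bottom contact becomes the vertex `s'`
carried by the wire at the `k`-th top contact (contacts are counted from `0`).

A negative transistor (bottom `x`, top `xax`) dissects the tree at its bottom: the root goes to the
`a`-wire, the subtree at the left (right) child of the root to the left (right) `x`-wire.
A positive transistor (bottom `xax`, top `x`) assembles a tree from two trees and a vertex: the
vertex becomes the root, the left (right) tree becomes the subtree at its left (right) child. -/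
inductive Transports : List TreeLetter → List TreeLetter →
    ℕ → List Bool → ℕ → List Bool → Prop
  | dissect_root : Transports [.x] [.x, .a, .x] 0 [] 1 []
  | dissect_left (s : List Bool) : Transports [.x] [.x, .a, .x] 0 (false :: s) 0 s
  | dissect_right (s : List Bool) : Transports [.x] [.x, .a, .x] 0 (true :: s) 2 s
  | assemble_root : Transports [.x, .a, .x] [.x] 1 [] 0 []
  | assemble_left (s : List Bool) : Transports [.x, .a, .x] [.x] 0 s 0 (false :: s)
  | assemble_right (s : List Bool) : Transports [.x, .a, .x] [.x] 2 s 0 (true :: s)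

namespace BraidedDiagram

/-- A pair `(c, s)` stands for the vertex `s` carried by the wire with upper end `c`. If this wire
comes up to the `j`-th contact on the bottom of the transistor `t`, then the vertex is transported
through `t` to a wire whose lower end is at the `k`-th contact on the top of `t`. -/
inductive Step {u v : List TreeLetter} (D : BraidedDiagram treePresentation u v) :
    Contacts u D.bot × List Bool → Contacts u D.bot × List Bool → Prop
  | through (t : D.T) (j : Fin (D.bot t).length) (k : Fin (D.top t).length)
      (c : Contacts u D.bot) (s s' : List Bool) (hc : D.wire c = .inr ⟨t, k⟩)
      (h : Transports (D.bot t) (D.top t) j s k s') : Step D (.inr ⟨t, j⟩, s) (c, s')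

/-- The `(x, x)`-diagram `D` encodes the map `h` on the vertices of the infinite binary tree: start
with the vertex `s` of the tree carried by the wire attached to the bottom of the frame,
and follow it upwards through all the transistors; it arrives at the vertex `h s` of the
tree carried by the wire attached to the top of the frame. -/
def Encodes (D : BraidedDiagram treePresentation [.x] [.x]) (h : List Bool → List Bool) : Prop :=
  ∀ s, Relation.ReflTransGen D.Step
    (D.wire.symm (.inl ⟨0, Nat.one_pos⟩), s) (.inl ⟨0, Nat.one_pos⟩, h s)

end BraidedDiagram

/-! A transistor acts as a bijection between the vertices on its bottom wires and those on its top
wires, and the two signs act inversely to each other. So `Step` is a partial injection, and as the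
transistors are finite in number and strictly ordered, every vertex runs from the bottom of the
frame to its top: a diagram gives a bijection `perm`. As long as the path of a vertex `s` avoids the
`a`-wires, the whole subtree at `s` is carried along with it. An `a`-wire carries one vertex only,
so only finitely many `s` have a subtree that is not translated (`properDomain`), which is
membership in `QV`. Isomorphisms and removals of dipoles do not change `perm`, and concatenation
becomes composition. What remains is bijectivity.

Surjectivity: for `h` in `QV` the set `C = properDomain h` is finite and closed under prefixes. One
negative transistor for each `v ∈ C` cuts up the source tree, one positive transistor for each `v ∈
C` assembles the image tree at the root `h v`, and the wires join the pieces that correspond under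
`h` (`swapEquiv`, `exists_isNormal`). This normal form encodes `h` (`IsNormal.perm_eq`).

Injectivity: removing dipoles makes every diagram reduced (`exists_isReduced`). In a reduced diagram
no wire leads from the bottom of a negative transistor to the top of a positive one. Hence an
`x`-wire attached below to the frame or to a negative transistor carries a full subtree of the
source tree, and one attached above to the frame or to a positive transistor carries a full subtree
of the image tree. If a negative transistor dissected a subtree that is merely translated, it would
form a dipole with the positive transistor at the other end of its `a`-wire. So a reduced diagram is
the normal form of its own bijection (`IsReduced.isNormal`), and normal forms of the same bijection
are isomorphic (`IsNormal.iso`). No confluence of dipole removal is needed. -/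

/-! ### Transport of vertices through one transistor -/

namespace Transports

variable {b t : List TreeLetter} {j k j' k' : ℕ} {s s' r r' : List Bool}

/-- The two signs are mutually inverse. Thus every statement about going up through a transistor
also gives the one about going down; in particular injectivity of `Step` comes from `functional`. -/
theorem symm (h : Transports b t j s k s') : Transports t b k s' j s := by
  cases h <;> constructor

theorem functional (h : Transports b t j s k s') (h' : Transports b t j s k' r') :
    k = k' ∧ s' = r' := by
  cases h <;> cases h' <;> exact ⟨rfl, rfl⟩

theorem lt_length_top (h : Transports b t j s k s') : k < t.length := by
  cases h <;> simp

theorem eq_nil_of_bot (h : Transports b t j s k s') (hj : b[j]? = some .a) : s = [] := by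
  cases h <;> simp_all

theorem append (h : Transports b t j s k s') (hj : b[j]? = some .x) (hk : t[k]? = some .x)
    (r : List Bool) : Transports b t j (s ++ r) k (s' ++ r) := by
  cases h <;> first | (simp at hj; done) | (simp at hk; done) | constructor

theorem exists_of_rel (h : (t, b) ∈ treePresentation.rels ∨ (b, t) ∈ treePresentation.rels)
    (hj : j < b.length) (hs : b[j]? = some .a → s = []) : ∃ k s', Transports b t j s k s' := by
  simp only [treePresentation, Set.mem_singleton_iff, Prod.mk.injEq] at h
  obtain ⟨rfl, rfl⟩ | ⟨rfl, rfl⟩ := h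
  · simp only [List.length_cons, List.length_nil] at hj
    interval_cases j
    · exact ⟨_, _, assemble_left s⟩
    · obtain rfl := hs rfl
      exact ⟨_, _, assemble_root⟩
    · exact ⟨_, _, assemble_right s⟩
  · simp only [List.length_cons, List.length_nil] at hj
    obtain rfl : j = 0 := by omega
    rcases s with _ | ⟨_ | _, s⟩
    · exact ⟨_, _, dissect_root⟩
    · exact ⟨_, _, dissect_left s⟩
    · exact ⟨_, _, dissect_right s⟩

end Transports

theorem some_contactLabel_inr {α T : Type*} (w : List α) (lab : T → List α) (t : T)
    (j : Fin (lab t).length) : some (contactLabel w lab (.inr ⟨t, j⟩)) = (lab t)[(j : ℕ)]? := by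
  simp [contactLabel]

theorem inr_mk_eq {α T : Type*} {w : List α} {lab : T → List α} {t t' : T} {n n' : ℕ}
    {h : n < (lab t).length} {h' : n' < (lab t').length} :
    (.inr ⟨t, n, h⟩ : Contacts w lab) = .inr ⟨t', n', h'⟩ ↔ t = t' ∧ n = n' := by
  constructor
  · intro e
    cases Sum.inr.inj e
    exact ⟨rfl, rfl⟩
  · rintro ⟨rfl, rfl⟩
    rfl

/-! ### Paths of vertices through a diagram -/

namespace BraidedDiagram

section wellFounded

variable {α : Type*} {P : SemigroupPresentation α} {u v : List α} (D : BraidedDiagram P u v)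

/-- The wire with upper end `c'` has its lower end on the top of a transistor whose bottom
carries `c`. -/
def Above (c' c : Contacts u D.bot) : Prop :=
  ∃ t j k, c = .inr ⟨t, j⟩ ∧ D.wire c' = .inr ⟨t, k⟩

theorem finite_contacts : Finite (Contacts u D.bot) := by
  have := D.finite_T
  infer_instance

theorem wellFounded_above : WellFounded D.Above := by
  have := D.finite_T
  let r : D.T → D.T → Prop := fun s t => ∃ j k, D.wire (.inr ⟨s, j⟩) = .inr ⟨t, k⟩
  have hr : WellFounded (Relation.TransGen r) := by
    have : Std.Irrefl (Relation.TransGen r) :=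
      ⟨fun t ht => D.acyclic t (by rw [← Relation.transGen_swap] at ht; exact ht)⟩
    exact Finite.wellFounded_of_trans_of_irrefl _
  have inl : ∀ i, Acc D.Above (.inl i) := fun i => ⟨_, fun c' ⟨_, _, _, h, _⟩ => by cases h⟩
  have inr : ∀ t j, Acc D.Above (.inr ⟨t, j⟩) := by
    intro t
    induction t using hr.induction with
    | _ t ih =>
      refine fun j => ⟨_, fun c' ⟨t', j', k', h, hw⟩ => ?_⟩
      cases Sum.inr.inj h
      rcases c' with i | ⟨s, l⟩
      · exact inl i
      · exact ih s (.single ⟨l, k', hw⟩) l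
  exact ⟨fun c => by rcases c with i | ⟨t, j⟩; exacts [inl i, inr t j]⟩

/-- On a finite set an acyclic relation is well-founded in both directions; this one serves to trace
paths downwards. -/
theorem wellFounded_below : WellFounded fun c c' => D.Above c' c := by
  have := D.finite_contacts
  have h : WellFounded (Relation.TransGen fun c c' => D.Above c' c) := by
    have : Std.Irrefl (Relation.TransGen fun c c' => D.Above c' c) :=
      ⟨fun c hc => D.wellFounded_above.transGen.irrefl.irrefl c
        (by rw [← Relation.transGen_swap] at hc; exact hc)⟩
    exact Finite.wellFounded_of_trans_of_irrefl _
  exact h.mono fun c c' (hc : D.Above c' c) => Relation.TransGen.single (r := fun c c' => D.Above c' c) hc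

end wellFounded

variable {u v : List TreeLetter} {D : BraidedDiagram treePresentation u v}

/-- The pair `(c, s)` stands for a vertex: if the wire carries a single vertex then `s` is empty. -/
def IsVertex (D : BraidedDiagram treePresentation u v) (p : Contacts u D.bot × List Bool) : Prop :=
  contactLabel u D.bot p.1 = .a → p.2 = []

theorem isVertex_of_label {c : Contacts u D.bot} (h : contactLabel u D.bot c = .x)
    (s : List Bool) : D.IsVertex (c, s) := fun ha => by
  rw [h] at ha; cases ha

theorem isVertex_nil (c : Contacts u D.bot) : D.IsVertex (c, []) := fun _ => rfl

theorem contactLabel_eq_of_wire {c : Contacts u D.bot} {t : D.T} {k : Fin (D.top t).length}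
    (h : D.wire c = .inr ⟨t, k⟩) : some (contactLabel u D.bot c) = (D.top t)[(k : ℕ)]? := by
  rw [← D.wire_label, h, some_contactLabel_inr]

namespace Step

variable {p q p' q' : Contacts u D.bot × List Bool}

theorem functional (h : D.Step p q) (h' : D.Step p q') : q = q' := by
  obtain ⟨t, j, k, c, s, s', hc, h⟩ := h
  obtain ⟨_, _, k', c', _, r', hc', h'⟩ := h'
  obtain ⟨hk, rfl⟩ := h.functional h'
  obtain rfl := Fin.ext hk
  rw [D.wire.injective (hc.trans hc'.symm)]

theorem injective (h : D.Step p q) (h' : D.Step p' q) : p = p' := by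
  obtain ⟨t, j, k, c, s, s', hc, h⟩ := h
  generalize hq : (c, s') = q at h'
  obtain ⟨t', j', k', c', r, r', hc', h'⟩ := h'
  cases hq
  cases Sum.inr.inj (hc.symm.trans hc')
  obtain ⟨hj, rfl⟩ := h.symm.functional h'.symm
  obtain rfl := Fin.ext hj
  rfl

theorem isVertex_left (h : D.Step p q) : D.IsVertex p := by
  obtain ⟨t, j, k, c, s, s', hc, h⟩ := h
  intro ha
  exact h.eq_nil_of_bot (by rw [← ha]; exact (some_contactLabel_inr ..).symm)

theorem isVertex_right (h : D.Step p q) : D.IsVertex q := by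
  obtain ⟨t, j, k, c, s, s', hc, h⟩ := h
  intro ha
  exact h.symm.eq_nil_of_bot (by rw [← ha]; exact (contactLabel_eq_of_wire hc).symm)

theorem above (h : D.Step p q) : D.Above q.1 p.1 := by
  obtain ⟨t, j, k, c, s, s', hc, h⟩ := h
  exact ⟨t, j, k, rfl, hc⟩

theorem append (h : D.Step p q) (hp : contactLabel u D.bot p.1 = .x)
    (hq : contactLabel u D.bot q.1 = .x) (r : List Bool) :
    D.Step (p.1, p.2 ++ r) (q.1, q.2 ++ r) := by
  obtain ⟨t, j, k, c, s, s', hc, h⟩ := h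
  exact .through t j k c _ _ hc (h.append (by rw [← hp]; exact (some_contactLabel_inr ..).symm)
    (by rw [← hq]; exact (contactLabel_eq_of_wire hc).symm) r)

end Step

theorem exists_step {t : D.T} {j : Fin (D.bot t).length} {s : List Bool}
    (h : D.IsVertex (.inr ⟨t, j⟩, s)) : ∃ q, D.Step (.inr ⟨t, j⟩, s) q := by
  obtain ⟨k, s', hk⟩ := Transports.exists_of_rel (D.rel_mem t) j.2
    (fun ha => h (Option.some.inj ((some_contactLabel_inr ..).trans ha)))
  exact ⟨_, .through t j ⟨k, hk.lt_length_top⟩ _ _ _ (D.wire.apply_symm_apply _) hk⟩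

theorem exists_step_to {c : Contacts u D.bot} {t : D.T} {k : Fin (D.top t).length} {s : List Bool}
    (hc : D.wire c = .inr ⟨t, k⟩) (h : D.IsVertex (c, s)) : ∃ p, D.Step p (c, s) := by
  obtain ⟨j, s', hj⟩ := Transports.exists_of_rel (D.rel_mem t).symm k.2
    (fun ha => h (Option.some.inj ((contactLabel_eq_of_wire hc).trans ha)))
  exact ⟨_, .through t ⟨j, hj.lt_length_top⟩ k _ _ _ hc hj.symm⟩

theorem exists_end (c : Contacts u D.bot) : ∀ s, D.IsVertex (c, s) →
    ∃ i s', Relation.ReflTransGen D.Step (c, s) (.inl i, s') := by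
  induction c using D.wellFounded_above.induction with
  | _ c ih =>
    intro s hs
    rcases c with i | ⟨t, j⟩
    · exact ⟨i, s, .refl⟩
    · obtain ⟨⟨c', s'⟩, h⟩ := exists_step hs
      obtain ⟨i, r, hr⟩ := ih c' h.above s' h.isVertex_right
      exact ⟨i, r, .head h hr⟩

theorem exists_start (c : Contacts u D.bot) : ∀ s, D.IsVertex (c, s) →
    ∃ i s', Relation.ReflTransGen D.Step (D.wire.symm (.inl i), s') (c, s) := by
  induction c using D.wellFounded_below.induction with
  | _ c ih =>
    intro s hs
    rcases hc : D.wire c with i | ⟨t, k⟩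
    · refine ⟨i, s, ?_⟩
      rw [← hc, Equiv.symm_apply_apply]
    · obtain ⟨⟨c', s'⟩, h⟩ := exists_step_to hc hs
      obtain ⟨i, r, hr⟩ := ih c' h.above s' h.isVertex_left
      exact ⟨i, r, .tail hr h⟩

theorem reflTransGen_inl {i : Fin u.length} {s : List Bool} {q : Contacts u D.bot × List Bool}
    (h : Relation.ReflTransGen D.Step (.inl i, s) q) : q = (.inl i, s) := by
  rcases Relation.ReflTransGen.cases_head h with h | ⟨_, h, _⟩
  · exact h.symm
  · cases h

theorem reflTransGen_start {i : Fin v.length} {s : List Bool} {p : Contacts u D.bot × List Bool}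
    (h : Relation.ReflTransGen D.Step p (D.wire.symm (.inl i), s)) :
    p = (D.wire.symm (.inl i), s) := by
  rcases Relation.ReflTransGen.cases_tail h with h | ⟨_, _, h⟩
  · exact h.symm
  · obtain ⟨t, j, k, hj, hw⟩ := h.above
    rw [Equiv.apply_symm_apply] at hw
    cases hw

theorem reflTransGen_total_of_left {p q q' : Contacts u D.bot × List Bool}
    (h : Relation.ReflTransGen D.Step p q) (h' : Relation.ReflTransGen D.Step p q') :
    Relation.ReflTransGen D.Step q q' ∨ Relation.ReflTransGen D.Step q' q :=
  Relation.ReflTransGen.total_of_right_unique (fun _ _ _ => Step.functional) h h'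

theorem reflTransGen_total_of_right {p p' q : Contacts u D.bot × List Bool}
    (h : Relation.ReflTransGen D.Step p q) (h' : Relation.ReflTransGen D.Step p' q) :
    Relation.ReflTransGen D.Step p p' ∨ Relation.ReflTransGen D.Step p' p := by
  have hu : Relator.RightUnique (Function.swap D.Step) := fun _ _ _ => Step.injective
  rw [← Relation.reflTransGen_swap] at h h'
  refine (Relation.ReflTransGen.total_of_right_unique hu h h').symm.imp ?_ ?_ <;>
  · intro h
    rw [← Relation.reflTransGen_swap] at h
    exact h

end BraidedDiagram
-- The bijection encoded by a diagram
namespace BraidedDiagram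

section treeDiagram

variable {D D' E : BraidedDiagram treePresentation [.x] [.x]}

/-- The wire attached to the bottom of the frame. -/
def source (D : BraidedDiagram treePresentation [.x] [.x]) : Contacts [.x] D.bot :=
  D.wire.symm (.inl ⟨0, Nat.one_pos⟩)

theorem inl_eq {T : Type} {lab : T → List TreeLetter} (i : Fin [TreeLetter.x].length) :
    (.inl i : Contacts [.x] lab) = .inl ⟨0, Nat.one_pos⟩ := by
  exact congrArg Sum.inl (Fin.ext (by simp))

theorem contactLabel_inl {T : Type} {lab : T → List TreeLetter} (i : Fin [TreeLetter.x].length) :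
    contactLabel [.x] lab (.inl i) = .x := by
  rw [inl_eq]; rfl

theorem contactLabel_source : contactLabel _ D.bot D.source = .x := by
  rw [source, ← D.wire_label, Equiv.apply_symm_apply, contactLabel_inl]

open Classical in
/-- The vertex of the tree on the top wire of the frame at which one arrives by following upwards
a vertex carried by some wire. -/
noncomputable def endOf (D : BraidedDiagram treePresentation [.x] [.x]) (p : Contacts [.x] D.bot × List Bool) :
    List Bool :=
  if h : D.IsVertex p then (exists_end p.1 p.2 h).choose_spec.choose else []

/-- Outside `IsVertex`, that is for a non-empty sequence on an `a`-wire, `endOf` has the junk value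
`[]`. -/
theorem reflTransGen_endOf {p : Contacts [.x] D.bot × List Bool} (h : D.IsVertex p) :
    Relation.ReflTransGen D.Step p (.inl ⟨0, Nat.one_pos⟩, D.endOf p) := by
  rw [endOf, dif_pos h, ← inl_eq (exists_end p.1 p.2 h).choose]
  exact (exists_end p.1 p.2 h).choose_spec.choose_spec

theorem eq_endOf {p : Contacts [.x] D.bot × List Bool} (h : D.IsVertex p) {s : List Bool}
    (hs : Relation.ReflTransGen D.Step p (.inl ⟨0, Nat.one_pos⟩, s)) : s = D.endOf p := by
  rcases reflTransGen_total_of_left hs (reflTransGen_endOf h) with h | h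
  · exact (Prod.ext_iff.1 (reflTransGen_inl h)).2.symm
  · exact (Prod.ext_iff.1 (reflTransGen_inl h)).2

theorem endOf_inl (i : Fin [TreeLetter.x].length) (s : List Bool) :
    D.endOf (.inl i, s) = s := by
  rw [inl_eq]
  exact (eq_endOf (isVertex_of_label rfl s) .refl).symm

theorem Step.endOf_eq {p q : Contacts [.x] D.bot × List Bool} (h : D.Step p q) :
    D.endOf p = D.endOf q :=
  (eq_endOf h.isVertex_left (.head h (reflTransGen_endOf h.isVertex_right))).symm

theorem endOf_eq_of_reflTransGen {p q : Contacts [.x] D.bot × List Bool}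
    (h : Relation.ReflTransGen D.Step p q) : D.endOf p = D.endOf q := by
  induction h with
  | refl => rfl
  | tail _ h ih => exact ih.trans h.endOf_eq

theorem reflTransGen_total_of_endOf_eq {p q : Contacts [.x] D.bot × List Bool}
    (hp : D.IsVertex p) (hq : D.IsVertex q) (h : D.endOf p = D.endOf q) :
    Relation.ReflTransGen D.Step p q ∨ Relation.ReflTransGen D.Step q p :=
  reflTransGen_total_of_right (h ▸ reflTransGen_endOf hp) (reflTransGen_endOf hq)

/-- Two paths with the same end are nested because `Step` is injective, and no path enters the
source wire from below; this gives injectivity. Surjectivity follows by tracing a vertex of the top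
wire downwards. -/
theorem bijective_endOf_source (D : BraidedDiagram treePresentation [.x] [.x]) :
    Function.Bijective fun s => D.endOf (D.source, s) := by
  have hv := isVertex_of_label (contactLabel_source (D := D))
  refine ⟨fun s s' h => ?_, fun s => ?_⟩
  · rcases reflTransGen_total_of_endOf_eq (hv s) (hv s') h with h | h
    · exact (Prod.ext_iff.1 (reflTransGen_start h)).2
    · exact (Prod.ext_iff.1 (reflTransGen_start h)).2.symm
  · obtain ⟨i, s', h⟩ := exists_start (D := D) (.inl ⟨0, Nat.one_pos⟩) s
      (isVertex_of_label rfl s)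
    rw [inl_eq] at h
    exact ⟨s', (eq_endOf (hv s') h).symm⟩

/-- The bijection encoded by a diagram. -/
noncomputable def perm (D : BraidedDiagram treePresentation [.x] [.x]) : Equiv.Perm (List Bool) :=
  Equiv.ofBijective _ D.bijective_endOf_source

theorem encodes_perm : D.Encodes D.perm := fun s =>
  reflTransGen_endOf (isVertex_of_label contactLabel_source s)

theorem Encodes.eq_perm {h : List Bool → List Bool} (hh : D.Encodes h) : h = D.perm :=
  funext fun s => eq_endOf (isVertex_of_label contactLabel_source s) (hh s)

theorem endOf_eq_iff {p : Contacts [.x] D.bot × List Bool} (hp : D.IsVertex p) {s : List Bool} :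
    D.endOf p = D.perm s ↔ Relation.ReflTransGen D.Step (D.source, s) p := by
  refine ⟨fun h => ?_, fun h => (endOf_eq_of_reflTransGen h).symm⟩
  rcases reflTransGen_total_of_endOf_eq hp (isVertex_of_label contactLabel_source s) h with h | h
  · rw [reflTransGen_start h]; exact .refl
  · exact h

/-- Between two `x`-wires a transistor only adds or deletes the first letter of a sequence, so a
suffix `r` is carried along untouched. Only an `a`-wire can separate a vertex from the subtree at
it. -/
theorem append_or_exists_label_a {p q : Contacts [.x] D.bot × List Bool}
    (hp : contactLabel _ D.bot p.1 = .x) (h : Relation.ReflTransGen D.Step p q) :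
    (∃ c, contactLabel _ D.bot c = .a ∧ Relation.ReflTransGen D.Step p (c, [])) ∨
      (contactLabel _ D.bot q.1 = .x ∧
        ∀ r, Relation.ReflTransGen D.Step (p.1, p.2 ++ r) (q.1, q.2 ++ r)) := by
  induction h with
  | refl => exact .inr ⟨hp, fun _ => .refl⟩
  | @tail q q' hq h ih =>
    rcases ih with ih | ⟨hx, ih⟩
    · exact .inl ih
    · rcases hx' : contactLabel _ D.bot q'.1 with _ | _
      · exact .inr ⟨rfl, fun r => .tail (ih r) (h.append hx hx' r)⟩
      · refine .inl ⟨q'.1, hx', .tail hq ?_⟩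
        rwa [← h.isVertex_right hx']

end treeDiagram

end BraidedDiagram

/-! ### The proper domain and membership in `QV` -/

/-- The vertices above which `h` does not act as a translation of subtrees. -/
def properDomain (h : List Bool → List Bool) : Set (List Bool) :=
  {s | ∃ r, h (s ++ r) ≠ h s ++ r}

theorem apply_append_of_notMem_properDomain {h : List Bool → List Bool} {s : List Bool}
    (hs : s ∉ properDomain h) (r : List Bool) : h (s ++ r) = h s ++ r := by
  by_contra hr
  exact hs ⟨r, hr⟩

theorem notMem_properDomain {h : List Bool → List Bool} {s : List Bool} :
    s ∉ properDomain h ↔ ∀ r, h (s ++ r) = h s ++ r :=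
  ⟨apply_append_of_notMem_properDomain, fun hs ⟨r, hr⟩ => hr (hs r)⟩

/-- The proper domain is closed under prefixes: it is empty or the vertex set of a subtree
containing the root. -/
theorem mem_properDomain_of_append {h : List Bool → List Bool} {s r : List Bool}
    (hs : s ++ r ∈ properDomain h) : s ∈ properDomain h := by
  by_contra hc
  rw [notMem_properDomain] at hc
  refine notMem_properDomain.2 (fun r' => ?_) hs
  rw [List.append_assoc, hc, hc, List.append_assoc]

theorem mem_QV_of_finite_properDomain {h : Equiv.Perm (List Bool)} (hh : (properDomain h).Finite) :
    h ∈ QV :=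
  hh.subset fun _ hv => by
    by_contra hc
    exact hv ⟨apply_append_of_notMem_properDomain hc _, apply_append_of_notMem_properDomain hc _⟩

/-- If no extension of `s` violates the condition on children, then `h` translates the subtree at
`s`, by induction along `r`. So the proper domain lies among the prefixes of the finitely many
exceptional vertices. -/
theorem finite_properDomain {h : Equiv.Perm (List Bool)} (hh : h ∈ QV) :
    (properDomain h).Finite := by
  refine ((show Set.Finite {v | _} from hh).biUnion fun u _ =>
    (List.finite_toSet u.inits)).subset fun s hs => ?_
  by_contra hc
  refine notMem_properDomain.2 (fun r => ?_) hs
  induction r using List.reverseRecOn with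
  | nil => simp
  | append_singleton r b ih =>
    rw [← List.append_assoc, ← List.append_assoc, ← ih]
    by_contra hb
    refine hc (Set.mem_biUnion (x := s ++ r) (fun hr => hb ?_) (by simp))
    cases b
    exacts [hr.1, hr.2]

/-! ### The bijection lies in `QV` and is compatible with equivalence and concatenation -/

namespace BraidedDiagram

variable {D D' E : BraidedDiagram treePresentation [.x] [.x]}

theorem exists_label_a_of_mem_properDomain {s : List Bool} (hs : s ∈ properDomain D.perm) :
    ∃ c, contactLabel _ D.bot c = .a ∧ D.endOf (c, []) = D.perm s := by
  rcases append_or_exists_label_a contactLabel_source (encodes_perm s) with ⟨c, hc, h⟩ | ⟨-, h⟩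
  · exact ⟨c, hc, (endOf_eq_iff (isVertex_nil c)).2 h⟩
  · exact absurd hs (notMem_properDomain.2 fun r =>
      (eq_endOf (isVertex_of_label contactLabel_source _) (h r)).symm)

theorem perm_mem_QV (D : BraidedDiagram treePresentation [.x] [.x]) : D.perm ∈ QV := by
  have := D.finite_contacts
  refine mem_QV_of_finite_properDomain (((Set.finite_range fun c => D.endOf (c, [])).preimage
    D.perm.injective.injOn).subset fun s hs => ?_)
  obtain ⟨c, -, hc⟩ := exists_label_a_of_mem_properDomain hs
  exact ⟨c, hc⟩

section invariance

theorem contactLabel_mapContacts {α T T' : Type*} (w : List α) {lab : T → List α}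
    {lab' : T' → List α} (f : T → T') (h : ∀ t, lab' (f t) = lab t) (c : Contacts w lab) :
    contactLabel w lab' (mapContacts w f h c) = contactLabel w lab c := by
  rcases c with i | ⟨t, j⟩
  · rfl
  · refine Option.some.inj ((some_contactLabel_inr ..).trans (.trans ?_
      (some_contactLabel_inr ..).symm))
    exact congrArg (fun l : List α => l[(j : ℕ)]?) (h t)

theorem Iso.perm_eq (h : Iso D D') : D.perm = D'.perm := by
  obtain ⟨e, htop, hbot, hw⟩ := h
  refine DFunLike.coe_injective (Encodes.eq_perm fun s => ?_)
  have hstart : D'.source = mapContacts _ e hbot D.source := by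
    refine D'.wire.symm_apply_eq.2 ?_
    rw [hw, source, Equiv.apply_symm_apply]
    rfl
  have key := (encodes_perm (D := D) s).lift (p := D'.Step)
    (fun p => (mapContacts _ e hbot p.1, p.2)) (fun p q hpq => ?_)
  · rw [← source, hstart]
    exact key
  · obtain ⟨t, j, k, c, s, s', hc, h⟩ := hpq
    refine .through (e t) (j.cast _) (k.cast (congrArg List.length (htop t).symm)) _ _ _
      (by rw [hw, hc]; rfl) ?_
    change Transports _ _ (j : ℕ) _ (k : ℕ) _
    rwa [htop, hbot]

/-- With a single relation, one label of a transistor determines the other. So the transistors of a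
dipole have opposite signs and transport vertices inversely. -/
theorem IsDipole.top_eq {t₁ t₂ : D.T} (h : D.IsDipole t₁ t₂) : D.top t₁ = D.bot t₂ := by
  have h₀ := h.label_eq
  have h₁ := D.rel_mem t₁
  have h₂ := D.rel_mem t₂
  simp only [treePresentation, Set.mem_singleton_iff, Prod.mk.injEq] at h₁ h₂
  rcases h₁ with h₁ | h₁ <;> rcases h₂ with h₂ | h₂ <;> simp_all

theorem RemovesDipole.perm_eq (h : RemovesDipole D D') : D.perm = D'.perm := by
  obtain ⟨t₁, t₂, hd, f, htop, hbot, -, -, hw⟩ := h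
  symm
  refine DFunLike.coe_injective (Encodes.eq_perm fun s => ?_)
  -- A wire of `D'` is either a wire of `D` or two wires of `D` spliced across the dipole. In the
  -- second case the vertex passes through `t₁` and then `t₂`, whose effects cancel.
  have key : ∀ c s, D'.IsVertex (c, s) → Relation.ReflTransGen D.Step
      (D.wire.symm (mapContacts _ f htop (D'.wire c)), s) (mapContacts _ f hbot c, s) := by
    intro c s hs
    by_cases hc : ∃ k, D.wire (mapContacts _ f hbot c) = .inr ⟨t₂, k⟩
    · obtain ⟨k, hk⟩ := hc
      rw [(hw c).1 k hk, Equiv.symm_apply_apply]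
      obtain ⟨p, hp⟩ := exists_step_to hk (s := s) (fun ha => hs
        ((contactLabel_mapContacts _ f hbot c).symm.trans ha))
      refine .head ?_ (.single hp)
      generalize hq : (mapContacts _ f hbot c, s) = q at hp
      obtain ⟨t, i, k', c', s', r, hc', h⟩ := hp
      cases hq
      cases Sum.inr.inj (hk.symm.trans hc')
      refine .through t₁ _ (i.cast hd.length_eq.symm) _ _ _ (hd.wire_eq (i.cast _)) ?_
      change Transports _ _ (k : ℕ) _ (i : ℕ) _
      rw [hd.top_eq, ← hd.label_eq]
      exact h.symm
    · rw [(hw c).2 (not_exists.1 hc), Equiv.symm_apply_apply]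
  have hs : Relation.ReflTransGen D.Step (D.source, s) (mapContacts _ f hbot D'.source, s) := by
    convert key D'.source s (isVertex_of_label contactLabel_source s) using 2
    rw [source, source, Equiv.apply_symm_apply]
    rfl
  refine hs.trans ?_
  refine Relation.ReflTransGen.lift' (p := D.Step)
    (fun p : Contacts _ D'.bot × List Bool => (mapContacts _ f hbot p.1, p.2))
    (fun p q hpq => ?_) _ _ (encodes_perm (D := D') s)
  have hv := hpq.isVertex_right
  obtain ⟨t, j, k, c, s, s', hc, h⟩ := hpq
  refine .head (.through (f t) (j.cast _) (k.cast (congrArg List.length (htop t).symm)) _ _ s'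
    (D.wire.apply_symm_apply _) ?_) ?_
  · change Transports _ _ (j : ℕ) _ (k : ℕ) _
    rwa [htop, hbot]
  · have := key c s' hv
    rwa [hc] at this

theorem perm_eq_of_dipoleSetoid (h : dipoleSetoid treePresentation [.x] [.x] D D') :
    D.perm = D'.perm := by
  induction h with
  | rel _ _ h => exact h.elim Iso.perm_eq RemovesDipole.perm_eq
  | refl => rfl
  | symm _ _ _ ih => exact ih.symm
  | trans _ _ _ _ _ ih ih' => exact ih.trans ih'

theorem perm_concat : (D.concat E).perm = D.perm * E.perm := by
  symm
  refine DFunLike.coe_injective (Encodes.eq_perm fun s => ?_)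
  have hE := (encodes_perm (D := E) s).lift (p := (D.concat E).Step)
    (fun p => (upperOfLower D E p.1, p.2)) (fun p q hpq => ?_)
  -- The path through `E` ends at the top of its frame, and `upperOfLower` identifies that wire with
  -- the source wire of `D`.
  · refine hE.trans ?_
    refine (encodes_perm (D := D) (E.perm s)).lift (p := (D.concat E).Step)
      (fun p => (upperOfUpper D E p.1, p.2)) (fun p q hpq => ?_)
    obtain ⟨t, j, k, c, s, s', hc, h⟩ := hpq
    exact .through (D := D.concat E) (.inl t) j k _ _ _
      ((concatWire_upperOfUpper ..).trans (by rw [hc]; rfl)) h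
  · obtain ⟨t, j, k, c, s, s', hc, h⟩ := hpq
    exact .through (D := D.concat E) (.inr t) j k _ _ _
      ((concatWire_upperOfLower ..).trans (by rw [hc]; rfl)) h

end invariance

end BraidedDiagram

/-! ### Places of contacts and the wiring of a normal form -/

/-- The places that an end of a wire can take in a diagram in normal form. Transistors are named by
vertices: `branch v` is the single contact on one side of the transistor `v`, `middle v`
is the middle contact on its other side, and the remaining contacts, as well as the
contact on the frame, are named by the vertex whose subtree they carry. -/
inductive Place
  | branch (v : List Bool)
  | middle (v : List Bool)
  | node (v : List Bool)

namespace Place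

open Classical in
/-- Exchange `branch v` and `node v` for `v` in `C`. -/
noncomputable def swap (C : Set (List Bool)) : Place → Place
  | branch v => if v ∈ C then node v else branch v
  | middle v => middle v
  | node v => if v ∈ C then branch v else node v

theorem swap_swap (C : Set (List Bool)) (p : Place) : swap C (swap C p) = p := by
  cases p <;> simp only [swap] <;> split_ifs <;> simp_all

theorem swap_branch {C : Set (List Bool)} {v : List Bool} (hv : v ∈ C) :
    swap C (branch v) = node v := if_pos hv

/-- The places in a normal form whose transistors are named by `C`; the vertices are read through
the bijection `g`. -/
def range (g : Equiv.Perm (List Bool)) (C : Set (List Bool)) : Set Place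
  | branch v => v ∈ C
  | middle v => v ∈ C
  | node v => g v = [] ∨ ∃ u ∈ C, ∃ b, g v = g u ++ [b]

end Place

/-- The transistors, one side of which is labelled by `lab`, are named by the elements of `C`, one
for each `v ∈ C` and each of the two labels. -/
structure IsNaming {T : Type} (C : Set (List Bool)) (lab : T → List TreeLetter)
    (key : T → List Bool) : Prop where
  lab_eq : ∀ t, lab t = [.x] ∨ lab t = [.x, .a, .x]
  inj : ∀ t t', lab t = lab t' → key t = key t' → t = t'
  mem : ∀ t, key t ∈ C
  surj : ∀ v ∈ C, (∃ t, lab t = [.x] ∧ key t = v) ∧ ∃ t, lab t = [.x, .a, .x] ∧ key t = v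

/-- The place of a contact. -/
def place {T : Type} (g : Equiv.Perm (List Bool)) (lab : T → List TreeLetter)
    (key : T → List Bool) : Contacts [.x] lab → Place
  | .inl _ => .node (g.symm [])
  | .inr ⟨t, j⟩ =>
    if (lab t).length = 1 then .branch (key t)
    else if (j : ℕ) = 1 then .middle (key t)
    else .node (g.symm (g (key t) ++ [decide ((j : ℕ) = 2)]))

section place

variable {T : Type} {g : Equiv.Perm (List Bool)} {C : Set (List Bool)} {lab : T → List TreeLetter}
  {key : T → List Bool}

theorem place_branch {t : T} (ht : lab t = [.x]) (j : Fin (lab t).length) :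
    place g lab key (.inr ⟨t, j⟩) = .branch (key t) := by
  simp [place, ht]

theorem place_middle {t : T} (ht : lab t = [.x, .a, .x]) {j : Fin (lab t).length}
    (hj : (j : ℕ) = 1) : place g lab key (.inr ⟨t, j⟩) = .middle (key t) := by
  simp [place, ht, hj]

theorem place_left {t : T} (ht : lab t = [.x, .a, .x]) {j : Fin (lab t).length}
    (hj : (j : ℕ) = 0) :
    place g lab key (.inr ⟨t, j⟩) = .node (g.symm (g (key t) ++ [false])) := by
  simp [place, ht, hj]

theorem place_right {t : T} (ht : lab t = [.x, .a, .x]) {j : Fin (lab t).length}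
    (hj : (j : ℕ) = 2) :
    place g lab key (.inr ⟨t, j⟩) = .node (g.symm (g (key t) ++ [true])) := by
  simp [place, ht, hj]

theorem contacts_cases (hlab : ∀ t, lab t = [.x] ∨ lab t = [.x, .a, .x])
    (c : Contacts [TreeLetter.x] lab) :
    (c = .inl ⟨0, Nat.one_pos⟩) ∨ ∃ t j, c = .inr ⟨t, j⟩ ∧ ((lab t = [.x] ∧ (j : ℕ) = 0) ∨
      lab t = [.x, .a, .x] ∧ ((j : ℕ) = 0 ∨ (j : ℕ) = 1 ∨ (j : ℕ) = 2)) := by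
  rcases c with i | ⟨t, j⟩
  · exact .inl (BraidedDiagram.inl_eq i)
  · refine .inr ⟨t, j, rfl, (hlab t).imp (fun h => ⟨h, ?_⟩) (fun h => ⟨h, ?_⟩)⟩ <;>
    · have := j.2
      simp only [h, List.length_cons, List.length_nil] at this
      omega

theorem IsNaming.place_injective (h : IsNaming C lab key) :
    Function.Injective (place g lab key) := by
  intro c c' e
  have inj : ∀ {t t'} {j : Fin (lab t).length} {j' : Fin (lab t').length}, lab t = lab t' →
      key t = key t' → (j : ℕ) = j' →
      (.inr ⟨t, j⟩ : Contacts [TreeLetter.x] lab) = .inr ⟨t', j'⟩ :=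
    fun hl hk hj => inr_mk_eq.2 ⟨h.inj _ _ hl hk, hj⟩
  rcases contacts_cases h.lab_eq c with rfl | ⟨t, j, rfl, ⟨ht, hj⟩ | ⟨ht, hj | hj | hj⟩⟩ <;>
  rcases contacts_cases h.lab_eq c' with rfl | ⟨t', j', rfl, ⟨ht', hj'⟩ | ⟨ht', hj' | hj' | hj'⟩⟩ <;>
  simp [place, *] at e <;>
  first
  | rfl
  | exact inj (ht.trans ht'.symm) e (hj.trans hj'.symm)

/-- Together with `place_injective` this turns contacts into an explicit set of places, so that a
wiring can be given as a bijection of places. Upper ends are read with `g = h`, because positive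
transistors split the image tree, and lower ends with `g = 1`. -/
theorem IsNaming.range_place (h : IsNaming C lab key) :
    Set.range (place g lab key) = Place.range g C := by
  refine Set.Subset.antisymm ?_ ?_
  · rintro _ ⟨c, rfl⟩
    rcases contacts_cases h.lab_eq c with rfl | ⟨t, j, rfl, ⟨ht, hj⟩ | ⟨ht, hj | hj | hj⟩⟩
    · exact .inl (g.apply_symm_apply _)
    · rw [place_branch ht]; exact h.mem t
    · rw [place_left ht hj]; exact .inr ⟨_, h.mem t, _, g.apply_symm_apply _⟩
    · rw [place_middle ht hj]; exact h.mem t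
    · rw [place_right ht hj]; exact .inr ⟨_, h.mem t, _, g.apply_symm_apply _⟩
  · rintro (v | v | v) hv
    · obtain ⟨⟨t, ht, rfl⟩, -⟩ := h.surj v hv
      exact ⟨.inr ⟨t, ⟨0, by simp [ht]⟩⟩, place_branch ht _⟩
    · obtain ⟨-, t, ht, rfl⟩ := h.surj v hv
      exact ⟨.inr ⟨t, ⟨1, by simp [ht]⟩⟩, place_middle ht rfl⟩
    · obtain hv | ⟨u, hu, b, hv⟩ := hv
      · exact ⟨.inl ⟨0, Nat.one_pos⟩, congrArg _ (g.symm_apply_eq.2 hv.symm)⟩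
      · obtain ⟨-, t, ht, rfl⟩ := h.surj u hu
        cases b
        · exact ⟨.inr ⟨t, ⟨0, by simp [ht]⟩⟩, (place_left ht rfl).trans
            (congrArg _ (g.symm_apply_eq.2 hv.symm))⟩
        · exact ⟨.inr ⟨t, ⟨2, by simp [ht]⟩⟩, (place_right ht rfl).trans
            (congrArg _ (g.symm_apply_eq.2 hv.symm))⟩

theorem place_mapContacts {T' : Type} {lab' : T' → List TreeLetter} {key' : T' → List Bool}
    (f : T → T') (hl : ∀ t, lab' (f t) = lab t) (hk : ∀ t, key' (f t) = key t)
    (c : Contacts [.x] lab) :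
    place g lab' key' (mapContacts [.x] f hl c) = place g lab key c := by
  rcases c with i | ⟨t, j⟩
  · rfl
  · simp [mapContacts, place, hl, hk]

end place

section range

variable {h : Equiv.Perm (List Bool)}

/-- For `v` in the proper domain this is closure under prefixes. For `v` outside, a piece cut off in
the image tree must also be cut off in the source tree: if the parent of `v` were translated too, it
would be the `u` with `h v = h u ++ [b]`, which lies in the proper domain. -/
theorem swap_mem_range_one {p : Place} (hp : p ∈ Place.range h (properDomain h)) :
    p.swap (properDomain h) ∈ Place.range 1 (properDomain h) := by
  rcases p with v | v | v
  · rw [Place.swap_branch hp]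
    rcases List.eq_nil_or_concat v with rfl | ⟨u, b, rfl⟩
    · exact .inl rfl
    · rw [List.concat_eq_append] at hp
      exact .inr ⟨u, mem_properDomain_of_append hp, b, by simp⟩
  · exact hp
  · by_cases hv : v ∈ properDomain h
    · rw [Place.swap, if_pos hv]; exact hv
    · rw [Place.swap, if_neg hv]
      have hv' := apply_append_of_notMem_properDomain hv
      obtain hp | ⟨u, hu, b, hp⟩ := hp
      · left
        -- If `h v = []`, translation at `v` gives `h (v ++ h []) = h []`, whence `v = []`.
        have hn := hv' (h [])
        rw [hp, List.nil_append] at hn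
        exact (List.append_eq_nil_iff.1 (h.injective hn)).1
      · rcases List.eq_nil_or_concat v with rfl | ⟨w, b', rfl⟩
        · exact .inl rfl
        · rw [List.concat_eq_append] at *
          refine .inr ⟨w, by_contra fun hw => ?_, b', rfl⟩
          rw [apply_append_of_notMem_properDomain hw] at hp
          have := h.injective (List.append_inj' hp rfl).1
          exact hw (this ▸ hu)

theorem swap_mem_range {p : Place} (hp : p ∈ Place.range 1 (properDomain h)) :
    p.swap (properDomain h) ∈ Place.range h (properDomain h) := by
  rcases p with v | v | v
  · rw [Place.swap_branch hp]
    rcases List.eq_nil_or_concat (h v) with hv | ⟨w, b, hv⟩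
    · exact .inl hv
    · rw [List.concat_eq_append] at hv
      obtain ⟨u, rfl⟩ := h.surjective w
      refine .inr ⟨u, by_contra fun hu => hu ?_, b, hv⟩
      rw [← apply_append_of_notMem_properDomain hu] at hv
      exact mem_properDomain_of_append (h.injective hv ▸ hp)
  · exact hp
  · by_cases hv : v ∈ properDomain h
    · rw [Place.swap, if_pos hv]; exact hv
    · rw [Place.swap, if_neg hv]
      rcases List.eq_nil_or_concat (h v) with hw | ⟨w, b, hw⟩
      · exact .inl hw
      · rw [List.concat_eq_append] at hw
        obtain ⟨u, rfl⟩ := h.surjective w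
        refine .inr ⟨u, by_contra fun hu => ?_, b, hw⟩
        rw [← apply_append_of_notMem_properDomain hu] at hw
        obtain rfl := h.injective hw
        obtain hp | ⟨u', hu', b', hp⟩ := hp
        · simp at hp
        · exact hu ((List.append_inj' hp rfl).1 ▸ hu')

/-- The two ends of the wires of a normal form correspond to each other. -/
noncomputable def swapEquiv (h : Equiv.Perm (List Bool)) :
    Place.range h (properDomain h) ≃ Place.range 1 (properDomain h) where
  toFun p := ⟨p.1.swap _, swap_mem_range_one p.2⟩
  invFun p := ⟨p.1.swap _, swap_mem_range p.2⟩
  left_inv _ := Subtype.ext (Place.swap_swap _ _)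
  right_inv _ := Subtype.ext (Place.swap_swap _ _)

end range

/-! ### Normal forms: uniqueness, encoded bijection, existence -/

namespace BraidedDiagram

/-- The transistors are named by the proper domain of `h`, and the wires join the contacts in
accordance with `h`. -/
structure IsNormal (D : BraidedDiagram treePresentation [.x] [.x]) (h : Equiv.Perm (List Bool))
    (key : D.T → List Bool) : Prop where
  bot : IsNaming (properDomain h) D.bot key
  top : IsNaming (properDomain h) D.top key
  wire : ∀ c, place 1 D.top key (D.wire c) = (place h D.bot key c).swap (properDomain h)

variable {D D' : BraidedDiagram treePresentation [.x] [.x]} {h : Equiv.Perm (List Bool)}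
  {key : D.T → List Bool} {key' : D'.T → List Bool}

theorem label_cases (D : BraidedDiagram treePresentation [.x] [.x]) (t : D.T) :
    (D.top t = [.x] ∧ D.bot t = [.x, .a, .x]) ∨ (D.top t = [.x, .a, .x] ∧ D.bot t = [.x]) := by
  have h := D.rel_mem t
  simp only [treePresentation, Set.mem_singleton_iff, Prod.mk.injEq] at h
  exact h.imp id And.symm

theorem top_eq_of_bot_eq {t : D.T} {t' : D'.T} (h : D'.bot t' = D.bot t) :
    D'.top t' = D.top t := by
  rcases D.label_cases t with ⟨h₁, h₂⟩ | ⟨h₁, h₂⟩ <;>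
  rcases D'.label_cases t' with ⟨h₃, h₄⟩ | ⟨h₃, h₄⟩ <;> simp_all

/-- Transistors are matched by sign and name. The wires then agree because a contact is determined
by its place, and `h` alone prescribes which places are joined. -/
theorem IsNormal.iso (hD : D.IsNormal h key) (hD' : D'.IsNormal h key') : Iso D D' := by
  have ex : ∀ t, ∃ t', D'.bot t' = D.bot t ∧ key' t' = key t := by
    intro t
    obtain ⟨⟨s, hs, hks⟩, s', hs', hks'⟩ := hD'.bot.surj _ (hD.bot.mem t)
    rcases hD.bot.lab_eq t with ht | ht
    · exact ⟨s, hs.trans ht.symm, hks⟩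
    · exact ⟨s', hs'.trans ht.symm, hks'⟩
  choose e hb hk using ex
  have he : Function.Bijective e := by
    refine ⟨fun t t' ht => hD.bot.inj _ _ ?_ ?_, fun t => ?_⟩
    · rw [← hb, ht, hb]
    · rw [← hk, ht, hk]
    · obtain ⟨⟨s, hs, hks⟩, s', hs', hks'⟩ := hD.bot.surj _ (hD'.bot.mem t)
      rcases hD'.bot.lab_eq t with ht | ht
      · exact ⟨s, hD'.bot.inj _ _ ((hb s).trans (hs.trans ht.symm)) ((hk s).trans hks)⟩
      · exact ⟨s', hD'.bot.inj _ _ ((hb s').trans (hs'.trans ht.symm)) ((hk s').trans hks')⟩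
  have ht : ∀ t, D'.top (e t) = D.top t := fun t => top_eq_of_bot_eq (hb t)
  refine ⟨Equiv.ofBijective e he, ht, hb, fun c => hD'.top.place_injective (g := 1) ?_⟩
  rw [hD'.wire]
  exact (congrArg _ (place_mapContacts e hb hk c)).trans
    ((hD.wire c).symm.trans (place_mapContacts e ht hk _).symm)

theorem one_symm_apply (v : List Bool) : (Equiv.symm (1 : Equiv.Perm (List Bool))) v = v := rfl

/-- The vertex of the image tree that belongs to the vertex `s` on a wire whose upper end is at the
given place. -/
def _root_.Place.value (h : Equiv.Perm (List Bool)) : Place → List Bool → List Bool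
  | .branch v, s => h (v ++ s)
  | .middle v, _ => h v
  | .node v, s => h v ++ s

/-- The value read at the lower end of a wire: one ending at `node v` carries the subtree at `v` of
the source tree. If `v` is outside the proper domain, this agrees with reading it in the image tree.
-/
theorem value_swap_node (v s : List Bool) :
    ((Place.node v).swap (properDomain h)).value h s = h (v ++ s) := by
  rw [Place.swap]
  split_ifs with hv
  · rfl
  · exact (apply_append_of_notMem_properDomain hv s).symm

theorem value_swap_branch (v s : List Bool) :
    ((Place.branch v).swap (properDomain h)).value h s = h v ++ s := by
  rw [Place.swap]
  split_ifs with hv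
  · rfl
  · exact apply_append_of_notMem_properDomain hv s

theorem IsNormal.place_eq (hD : D.IsNormal h key) (c : Contacts [.x] D.bot) :
    place h D.bot key c = (place 1 D.top key (D.wire c)).swap (properDomain h) := by
  rw [hD.wire, Place.swap_swap]

theorem Step.label_cases {p q : Contacts [.x] D.bot × List Bool} (h : D.Step p q) :
    ∃ t j k, p.1 = .inr ⟨t, j⟩ ∧ D.wire q.1 = .inr ⟨t, k⟩ ∧
    ((D.bot t = [.x] ∧ D.top t = [.x, .a, .x] ∧ ((p.2 = [] ∧ (k : ℕ) = 1 ∧ q.2 = []) ∨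
      (p.2 = false :: q.2 ∧ (k : ℕ) = 0) ∨ (p.2 = true :: q.2 ∧ (k : ℕ) = 2))) ∨
    (D.bot t = [.x, .a, .x] ∧ D.top t = [.x] ∧ ((p.2 = [] ∧ (j : ℕ) = 1 ∧ q.2 = []) ∨
      (q.2 = false :: p.2 ∧ (j : ℕ) = 0) ∨ (q.2 = true :: p.2 ∧ (j : ℕ) = 2)))) := by
  obtain ⟨t, j, k, c, s, s', hc, h⟩ := h
  refine ⟨t, j, k, rfl, hc, ?_⟩
  generalize D.bot t = b, D.top t = l, (j : ℕ) = j, (k : ℕ) = k at h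
  cases h <;> simp

theorem IsNormal.value_eq (hD : D.IsNormal h key) {p q : Contacts [.x] D.bot × List Bool}
    (hpq : D.Step p q) :
    (place h D.bot key p.1).value h p.2 = (place h D.bot key q.1).value h q.2 := by
  obtain ⟨t, j, k, hp, hq, ⟨hb, ht, hpq⟩ | ⟨hb, ht, hpq⟩⟩ := hpq.label_cases
  · rw [hp, hD.place_eq q.1, hq, place_branch hb]
    obtain ⟨hp, hk, hq⟩ | ⟨hp, hk⟩ | ⟨hp, hk⟩ := hpq
    · rw [place_middle ht hk, hp, hq]
      simp [Place.value, Place.swap]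
    · rw [place_left ht hk, value_swap_node, hp]
      simp [Place.value, one_symm_apply]
    · rw [place_right ht hk, value_swap_node, hp]
      simp [Place.value, one_symm_apply]
  · rw [hp, hD.place_eq q.1, hq, place_branch ht, value_swap_branch]
    obtain ⟨hp, hk, hq⟩ | ⟨hp, hk⟩ | ⟨hp, hk⟩ := hpq
    · rw [place_middle hb hk, hp, hq]
      simp [Place.value]
    · rw [place_left hb hk, hp]
      simp [Place.value]
    · rw [place_right hb hk, hp]
      simp [Place.value]

theorem IsNormal.perm_eq (hD : D.IsNormal h key) : D.perm = h := by
  have key : ∀ {p q}, Relation.ReflTransGen D.Step p q →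
      (place h D.bot key p.1).value h p.2 = (place h D.bot key q.1).value h q.2 := by
    intro p q hpq
    induction hpq with
    | refl => rfl
    | tail _ hq ih => exact ih.trans (hD.value_eq hq)
  ext1 s
  -- The value is constant along a path. On the source wire it is `h s`, and on the top wire it is
  -- the vertex reached, `D.perm s`.
  have := key (encodes_perm (D := D) s)
  rw [hD.place_eq, Equiv.apply_symm_apply] at this
  simp only [place, value_swap_node] at this
  simpa [Place.value, one_symm_apply] using this.symm

/-- The label on one side of a transistor of the given sign. -/
def sideLabel : Bool → List TreeLetter
  | true => [.x, .a, .x]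
  | false => [.x]

theorem isNaming_sideLabel (C : Set (List Bool)) (σ : Bool → Bool) (hσ : Function.Bijective σ) :
    IsNaming C (fun t : Bool × C => sideLabel (σ t.1)) fun t => t.2 where
  lab_eq t := by cases σ t.1 <;> simp [sideLabel]
  inj := by
    rintro ⟨b, v⟩ ⟨b', v'⟩ h₁ h₂
    refine Prod.ext (hσ.1 ?_) (Subtype.ext h₂)
    change sideLabel (σ b) = sideLabel (σ b') at h₁
    revert h₁
    cases σ b <;> cases σ b' <;> simp [sideLabel]
  mem t := t.2.2
  surj v hv := by
    obtain ⟨b, hb⟩ := hσ.2 false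
    obtain ⟨b', hb'⟩ := hσ.2 true
    exact ⟨⟨(b, ⟨v, hv⟩), by simp [hb, sideLabel], rfl⟩, (b', ⟨v, hv⟩), by simp [hb', sideLabel],
      rfl⟩

/-- The label of the wires that end at a place. -/
def _root_.Place.letter : Place → TreeLetter
  | .branch _ => .x
  | .middle _ => .a
  | .node _ => .x

theorem letter_swap (C : Set (List Bool)) (p : Place) : (p.swap C).letter = p.letter := by
  cases p <;> simp only [Place.swap] <;> (try split_ifs) <;> rfl

theorem letter_place {T : Type} {lab : T → List TreeLetter} {key : T → List Bool}
    (hlab : ∀ t, lab t = [.x] ∨ lab t = [.x, .a, .x]) (c : Contacts [.x] lab) :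
    (place h lab key c).letter = contactLabel [.x] lab c := by
  rcases contacts_cases hlab c with rfl | ⟨t, j, rfl, hc⟩
  · rfl
  · refine Option.some.inj (.trans ?_ (some_contactLabel_inr ..).symm)
    rcases hc with ⟨ht, hj⟩ | ⟨ht, hj | hj | hj⟩
    · rw [place_branch ht, hj, ht]; rfl
    · rw [place_left ht hj, hj, ht]; rfl
    · rw [place_middle ht hj, hj, ht]; rfl
    · rw [place_right ht hj, hj, ht]; rfl

/-- In a normal form, the negative transistors lie below the positive ones, a negative transistor
is lower if its name is shorter, and a positive transistor is lower if the image of its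
name is longer. -/
def rank (h : Equiv.Perm (List Bool)) (σ : Bool) (v : List Bool) : Bool ×ₗ ℤ :=
  toLex (σ, bif σ then -((h v).length : ℤ) else v.length)

/-- Along a wire from `s` down to `t`, two negative transistors satisfy `s.2 = t.2 ++ [b]`, and two
positive ones satisfy `h t.2 = h s.2 ++ [b]`. A wire from a negative transistor down to a positive
one would join `node` to `branch`, which is impossible. -/
theorem rank_lt {C : Set (List Bool)} {t s : Bool × C}
    {j : Fin (sideLabel s.1).length} {k : Fin (sideLabel !t.1).length}
    (hw : place 1 (fun t : Bool × C => sideLabel !t.1) (fun t => t.2) (.inr ⟨t, k⟩) =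
      (place h (fun t : Bool × C => sideLabel t.1) (fun t => t.2) (.inr ⟨s, j⟩)).swap C) :
    rank h t.1 t.2 < rank h s.1 s.2 := by
  obtain ⟨_ | _, v, hv⟩ := s <;> obtain ⟨_ | _, v', hv'⟩ := t
  · rw [place_branch (t := ((false, ⟨v, hv⟩) : Bool × C)) (by rfl), Place.swap_branch hv] at hw
    simp only [place, sideLabel, Bool.not_false] at hw
    split_ifs at hw
    · simp only [Place.node.injEq, one_symm_apply, Equiv.Perm.one_apply] at hw
      simp [rank, Prod.Lex.toLex_lt_toLex, ← hw]
  · rw [place_branch (by rfl), place_branch (by rfl), Place.swap_branch hv] at hw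
    cases hw
  · simp [rank, Prod.Lex.toLex_lt_toLex]
  · rw [place_branch (t := ((true, ⟨v', hv'⟩) : Bool × C)) (by rfl)] at hw
    simp only [place, sideLabel] at hw
    split_ifs at hw
    · simp at *
    · cases hw
    · simp only [Place.swap] at hw
      split_ifs at hw
      simp only [Place.branch.injEq] at hw
      simp [rank, Prod.Lex.toLex_lt_toLex, hw]

theorem exists_isNormal (hh : (properDomain h).Finite) :
    ∃ (D : BraidedDiagram treePresentation [.x] [.x]) (key : D.T → List Bool),
      D.IsNormal h key := by
  let T := Bool × properDomain h
  let bot : T → List TreeLetter := fun t => sideLabel t.1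
  let top : T → List TreeLetter := fun t => sideLabel !t.1
  let key : T → List Bool := fun t => t.2
  have hbot : IsNaming (properDomain h) bot key :=
    isNaming_sideLabel _ id Function.bijective_id
  have htop : IsNaming (properDomain h) top key :=
    isNaming_sideLabel _ not Bool.involutive_not.bijective
  let wire : Contacts [.x] bot ≃ Contacts [.x] top :=
    (Equiv.ofInjective _ (hbot.place_injective (g := h))).trans <|
    (Equiv.setCongr hbot.range_place).trans <| (swapEquiv h).trans <|
    (Equiv.setCongr htop.range_place.symm).trans
    (Equiv.ofInjective _ (htop.place_injective (g := 1))).symm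
  have hwire : ∀ c, place 1 top key (wire c) = (place h bot key c).swap (properDomain h) := by
    intro c
    exact Equiv.apply_ofInjective_symm (htop.place_injective (g := 1)) _
  have hfin : Finite (properDomain h) := hh
  refine ⟨⟨T, inferInstance, top, bot, ?_, wire, fun c => ?_, fun t ht => ?_⟩, key, hbot, htop,
    hwire⟩
  · rintro ⟨_ | _, v⟩
    · exact .inr rfl
    · exact .inl rfl
  · rw [← letter_place (h := 1) htop.lab_eq, hwire, letter_swap, letter_place hbot.lab_eq]
  · have := ht.lift (fun t : T => rank h t.1 t.2) (p := (· < ·)) fun t s ⟨j, k, hw⟩ =>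
      rank_lt (by rw [← hwire]; exact congrArg (place 1 top key) hw.symm)
    rw [Relation.transGen_eq_self] at this
    exact lt_irrefl _ this

end BraidedDiagram

/-! ### Removal of dipoles and reduced diagrams -/

namespace BraidedDiagram

section removal

variable {α : Type*} {P : SemigroupPresentation α} {u v w : List α} {D : BraidedDiagram P u v}
  {t₁ t₂ : D.T}

theorem exists_mapContacts_val_eq {T : Type} {t₁ t₂ : T} {lab : T → List α} {c : Contacts w lab}
    (h₁ : ∀ j, c ≠ .inr ⟨t₁, j⟩) (h₂ : ∀ j, c ≠ .inr ⟨t₂, j⟩) :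
    ∃ c' : Contacts w (fun t : {t // t ≠ t₁ ∧ t ≠ t₂} => lab t),
      mapContacts w Subtype.val (fun _ => rfl) c' = c := by
  rcases c with i | ⟨t, j⟩
  · exact ⟨.inl i, rfl⟩
  · refine ⟨.inr ⟨⟨t, ?_, ?_⟩, j⟩, rfl⟩
    · rintro rfl; exact h₁ j rfl
    · rintro rfl; exact h₂ j rfl

theorem mapContacts_val_ne {T : Type} {p : T → Prop} {lab : T → List α} {t : T} (ht : ¬ p t)
    (c : Contacts w (fun t : {t // p t} => lab t)) (j) :
    mapContacts w (lab' := lab) Subtype.val (fun _ => rfl) c ≠ .inr ⟨t, j⟩ := by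
  rcases c with i | ⟨s, k⟩ <;> intro h
  · cases h
  · cases Sum.inr.inj h
    exact ht s.2

theorem mapContacts_injective {T T' : Type} {f : T' → T} (hf : Function.Injective f)
    {lab : T → List α} {lab' : T' → List α} (h : ∀ t, lab (f t) = lab' t) :
    Function.Injective (mapContacts w f h) := by
  rintro (i | ⟨t, j⟩) (i' | ⟨t', j'⟩) e
  · cases e; rfl
  · cases e
  · cases e
  · obtain ⟨ht, hj⟩ := inr_mk_eq.1 e
    exact inr_mk_eq.2 ⟨hf ht, hj⟩

/-- Since the top of `t₁` is non-empty, some wire puts `t₁` strictly below `t₂`. By acyclicity no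
wire goes from the bottom of `t₁` to the top of `t₂`, so each splice passes the dipole only once and
the new wiring is well defined. -/
theorem exists_removesDipole (h : D.IsDipole t₁ t₂) (hne : D.top t₁ ≠ []) :
    ∃ D' : BraidedDiagram P u v, RemovesDipole D D' ∧ Nat.card D'.T < Nat.card D.T := by
  have := D.finite_T
  let r : D.T → D.T → Prop := fun t s => ∃ j k, D.wire (.inr ⟨s, j⟩) = .inr ⟨t, k⟩
  have h₁₂ : r t₁ t₂ :=
    ⟨_, _, h.wire_eq ⟨0, List.length_pos_iff.2 hne⟩⟩
  have hac : ∀ t, ¬ Relation.TransGen r t t := D.acyclic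
  have hirr : ∀ t j k, D.wire (.inr ⟨t, j⟩) ≠ .inr ⟨t, k⟩ :=
    fun t j k hw => hac t (.single ⟨j, k, hw⟩)
  have h₂₁ : ∀ j k, D.wire (.inr ⟨t₁, j⟩) ≠ .inr ⟨t₂, k⟩ :=
    fun j k hw => hac t₁ (.tail (.single h₁₂) ⟨j, k, hw⟩)
  have hw₂ : ∀ j, ∃ k, D.wire (.inr ⟨t₂, j⟩) = .inr ⟨t₁, k⟩ :=
    fun j => ⟨j.cast h.length_eq.symm, h.wire_eq (j.cast h.length_eq.symm)⟩
  have hne' : t₁ ≠ t₂ := fun e => hac t₁ (.single (e ▸ h₁₂))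
  let T' := {t // t ≠ t₁ ∧ t ≠ t₂}
  let fu : Contacts u (fun t : T' => D.bot t) → Contacts u D.bot :=
    mapContacts u Subtype.val fun _ => rfl
  let fv : Contacts v (fun t : T' => D.top t) → Contacts v D.top :=
    mapContacts v Subtype.val fun _ => rfl
  have hfu : Function.Injective fu := mapContacts_injective Subtype.val_injective _
  have hfv : Function.Injective fv := mapContacts_injective Subtype.val_injective _
  have hfu₁ : ∀ c j, fu c ≠ .inr ⟨t₁, j⟩ := mapContacts_val_ne (by simp)
  have hfu₂ : ∀ c j, fu c ≠ .inr ⟨t₂, j⟩ := mapContacts_val_ne (by simp)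
  have hfv₁ : ∀ c j, fv c ≠ .inr ⟨t₁, j⟩ := mapContacts_val_ne (by simp)
  have hfv₂ : ∀ c j, fv c ≠ .inr ⟨t₂, j⟩ := mapContacts_val_ne (by simp)
  -- The condition that `RemovesDipole` imposes on a wire from `c` to `l`. It is shown to be the
  -- graph of a bijection.
  let R : Contacts u (fun t : T' => D.bot t) → Contacts v (fun t : T' => D.top t) → Prop :=
    fun c l => (∀ k, D.wire (fu c) = .inr ⟨t₂, k⟩ →
        fv l = D.wire (.inr ⟨t₁, k.cast (congrArg List.length h.label_eq)⟩)) ∧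
      ((∀ k, D.wire (fu c) ≠ .inr ⟨t₂, k⟩) → fv l = D.wire (fu c))
  have Rcases : ∀ {c l}, R c l → (∃ k, D.wire (fu c) = .inr ⟨t₂, k⟩ ∧
      fv l = D.wire (.inr ⟨t₁, k.cast (congrArg List.length h.label_eq)⟩)) ∨
      fv l = D.wire (fu c) := by
    intro c l hR
    by_cases hc : ∃ k, D.wire (fu c) = .inr ⟨t₂, k⟩
    · obtain ⟨k, hk⟩ := hc
      exact .inl ⟨k, hk, hR.1 k hk⟩
    · exact .inr (hR.2 (not_exists.1 hc))
  have ex : ∀ c, ∃ l, R c l := by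
    intro c
    by_cases hc : ∃ k, D.wire (fu c) = .inr ⟨t₂, k⟩
    · obtain ⟨k, hk⟩ := hc
      obtain ⟨l, hl⟩ := exists_mapContacts_val_eq (hirr t₁ _) (h₂₁ (k.cast
        (congrArg List.length h.label_eq)))
      refine ⟨l, fun k' hk' => ?_, fun hc => absurd hk (hc k)⟩
      cases Sum.inr.inj (hk.symm.trans hk')
      exact hl
    · obtain ⟨l, hl⟩ := exists_mapContacts_val_eq (c := D.wire (fu c)) (t₁ := t₁) (fun j hj => by
        have := h.wire_eq j
        exact hfu₂ _ _ (D.wire.injective (hj.trans this.symm))) (not_exists.1 hc)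
      exact ⟨l, fun k hk => absurd ⟨k, hk⟩ hc, fun _ => hl⟩
  choose g hg using ex
  have ginj : Function.Injective g := by
    intro c c' e
    have hc := hg c
    have hc' := hg c'
    rw [← e] at hc'
    rcases Rcases hc with ⟨k, hk, hl⟩ | hl <;> rcases Rcases hc' with ⟨k', hk', hl'⟩ | hl'
    · have e := (inr_mk_eq.1 (D.wire.injective (hl.symm.trans hl'))).2
      obtain rfl := Fin.ext e
      exact hfu (D.wire.injective (hk.trans hk'.symm))
    · exact absurd (D.wire.injective (hl'.symm.trans hl)) (hfu₁ _ _)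
    · exact absurd (D.wire.injective (hl.symm.trans hl')) (hfu₁ _ _)
    · exact hfu (D.wire.injective (hl.symm.trans hl'))
  have gsurj : Function.Surjective g := by
    intro l
    suffices hR : ∃ c, R c l by
      obtain ⟨c, hc⟩ := hR
      refine ⟨c, hfv ?_⟩
      by_cases hk : ∃ k, D.wire (fu c) = .inr ⟨t₂, k⟩
      · obtain ⟨k, hk⟩ := hk
        exact ((hg c).1 k hk).trans (hc.1 k hk).symm
      · exact ((hg c).2 (not_exists.1 hk)).trans (hc.2 (not_exists.1 hk)).symm
    -- A lower end reached from the bottom of `t₁` comes from the wire that enters the top of `t₂`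
    -- at the same position.
    by_cases hl : ∃ j, D.wire.symm (fv l) = .inr ⟨t₁, j⟩
    · obtain ⟨j, hj⟩ := hl
      let k : Fin (D.top t₂).length := j.cast (congrArg List.length h.label_eq.symm)
      obtain ⟨c, hc⟩ := exists_mapContacts_val_eq (t₁ := t₁) (t₂ := t₂)
        (c := D.wire.symm (.inr ⟨t₂, k⟩))
        (fun i hi => h₂₁ i k ((D.wire.symm_apply_eq).1 hi).symm)
        (fun i hi => hirr t₂ i k ((D.wire.symm_apply_eq).1 hi).symm)
      have hc' : D.wire (fu c) = .inr ⟨t₂, k⟩ :=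
        (congrArg D.wire hc).trans (D.wire.apply_symm_apply _)
      refine ⟨c, fun k' hk' => ?_, fun hk' => absurd hc' (hk' k)⟩
      cases Sum.inr.inj (hc'.symm.trans hk')
      exact (D.wire.symm_apply_eq).1 hj
    · obtain ⟨c, hc⟩ := exists_mapContacts_val_eq (c := D.wire.symm (fv l)) (t₂ := t₂)
        (not_exists.1 hl) (fun i hi => by
          obtain ⟨k, hk⟩ := hw₂ i
          exact hfv₁ l k (((D.wire.symm_apply_eq).1 hi).trans hk))
      have hc' : D.wire (fu c) = fv l := (congrArg D.wire hc).trans (D.wire.apply_symm_apply _)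
      exact ⟨c, fun k hk => absurd (hc'.symm.trans hk) (hfv₂ _ _), fun _ => hc'.symm⟩
  have hlabel : ∀ c, contactLabel v (fun t : T' => D.top t) (g c) =
      contactLabel u (fun t : T' => D.bot t) c := by
    intro c
    rw [← contactLabel_mapContacts v Subtype.val (lab' := D.top) (fun _ => rfl),
      ← contactLabel_mapContacts u Subtype.val (lab' := D.bot) (fun _ => rfl) c]
    change contactLabel v D.top (fv (g c)) = contactLabel u D.bot (fu c)
    rcases Rcases (hg c) with ⟨k, hk, hl⟩ | hl
    · rw [hl, D.wire_label, ← D.wire_label (fu c), hk]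
      refine Option.some.inj ((some_contactLabel_inr ..).trans (.trans ?_
        (some_contactLabel_inr ..).symm))
      exact congrArg (fun l : List α => l[(k : ℕ)]?) h.label_eq.symm
    · rw [hl, D.wire_label]
  refine ⟨⟨T', inferInstance, fun t => D.top t, fun t => D.bot t, fun t => D.rel_mem t,
    Equiv.ofBijective g ⟨ginj, gsurj⟩, hlabel, fun t ht => ?_⟩,
    ⟨t₁, t₂, h, Subtype.val, fun _ => rfl, fun _ => rfl, Subtype.val_injective,
      Subtype.range_val, hg⟩, ?_⟩
  · refine hac t.1 (ht.lift' Subtype.val fun t s ⟨j, k, hw⟩ => ?_)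
    have hw : g (.inr ⟨s, j⟩) = .inr ⟨t, k⟩ := hw
    have hR := hg (.inr ⟨s, j⟩)
    rw [hw] at hR
    rcases Rcases hR with ⟨i, hi, hl⟩ | hl
    -- A spliced wire from `s` to `t` comes from the chain `t`, `t₁`, `t₂`, `s` in `D`, so a cycle
    -- in the new diagram yields one in `D`.
    · exact .head (b := t₁) ⟨_, k, hl.symm⟩ (.head (b := t₂) h₁₂ (.single ⟨j, i, hi⟩))
    · exact .single ⟨j, k, hl.symm⟩
  · exact Finite.card_subtype_lt (x := t₁) (by simp)

end removal

/-- A diagram without dipoles. -/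
def IsReduced {α : Type*} {P : SemigroupPresentation α} {u v : List α}
    (D : BraidedDiagram P u v) : Prop :=
  ∀ t₁ t₂, ¬ D.IsDipole t₁ t₂

theorem exists_isReduced {α : Type*} {P : SemigroupPresentation α} {u v : List α}
    (D : BraidedDiagram P u v) : ∃ D', D'.IsReduced ∧ dipoleSetoid P u v D D' := by
  induction hn : Nat.card D.T using Nat.strong_induction_on generalizing D with
  | _ n ih =>
    by_cases hD : D.IsReduced
    · exact ⟨D, hD, Setoid.refl' _ D⟩
    · simp only [IsReduced, not_forall, not_not] at hD
      obtain ⟨t₁, t₂, h⟩ := hD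
      obtain ⟨D', h', hc⟩ := exists_removesDipole h
        ((D.rel_mem t₁).elim (P.left_ne_nil _) (P.right_ne_nil _))
      obtain ⟨D'', hr, he⟩ := ih _ (hn ▸ hc) D' rfl
      exact ⟨D'', hr, Setoid.trans' _ (.rel _ _ (.inr h')) he⟩

end BraidedDiagram

/-! ### Reduced diagrams are in normal form -/

namespace BraidedDiagram

variable {D : BraidedDiagram treePresentation [.x] [.x]}

theorem inr_congr {α T : Type*} {w : List α} {lab : T → List α} {t : T}
    {j j' : Fin (lab t).length} (h : (j : ℕ) = j') :
    (.inr ⟨t, j⟩ : Contacts w lab) = .inr ⟨t, j'⟩ := by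
  rw [Fin.ext h]

theorem place_outer {T : Type} {g : Equiv.Perm (List Bool)} {lab : T → List TreeLetter}
    {key : T → List Bool} {t : T} (ht : lab t = [.x, .a, .x]) {j : Fin (lab t).length}
    (hj : (j : ℕ) ≠ 1) :
    place g lab key (.inr ⟨t, j⟩) = .node (g.symm (g (key t) ++ [decide ((j : ℕ) = 2)])) := by
  simp [place, ht, hj]

theorem outer_cases {T : Type} {lab : T → List TreeLetter} {t : T} (ht : lab t = [.x, .a, .x])
    {j : Fin (lab t).length} (hj : (j : ℕ) ≠ 1) : (j : ℕ) = 0 ∨ (j : ℕ) = 2 := by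
  have := j.2
  simp only [ht, List.length_cons, List.length_nil] at this
  omega

theorem bot_cases (D : BraidedDiagram treePresentation [.x] [.x]) (t : D.T) :
    D.bot t = [.x] ∨ D.bot t = [.x, .a, .x] :=
  (D.label_cases t).symm.imp And.right And.right

theorem top_cases (D : BraidedDiagram treePresentation [.x] [.x]) (t : D.T) :
    D.top t = [.x] ∨ D.top t = [.x, .a, .x] :=
  (D.label_cases t).imp And.left And.left

theorem top_eq_of_bot_eq_x {t : D.T} (h : D.bot t = [.x]) : D.top t = [.x, .a, .x] := by
  rcases D.label_cases t with ⟨h₁, h₂⟩ | ⟨h₁, h₂⟩ <;> simp_all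

theorem top_eq_of_bot_eq_xax {t : D.T} (h : D.bot t = [.x, .a, .x]) : D.top t = [.x] := by
  rcases D.label_cases t with ⟨h₁, h₂⟩ | ⟨h₁, h₂⟩ <;> simp_all

theorem bot_eq_of_top_eq_x {t : D.T} (h : D.top t = [.x]) : D.bot t = [.x, .a, .x] := by
  rcases D.label_cases t with ⟨h₁, h₂⟩ | ⟨h₁, h₂⟩ <;> simp_all

theorem bot_eq_of_top_eq_xax {t : D.T} (h : D.top t = [.x, .a, .x]) : D.bot t = [.x] := by
  rcases D.label_cases t with ⟨h₁, h₂⟩ | ⟨h₁, h₂⟩ <;> simp_all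

section steps

variable {t : D.T} {j : Fin (D.bot t).length} {k : Fin (D.top t).length} {c : Contacts [.x] D.bot}

theorem step_assemble_root (hb : D.bot t = [.x, .a, .x]) (hc : D.wire c = .inr ⟨t, k⟩)
    (hj : (j : ℕ) = 1) : D.Step (.inr ⟨t, j⟩, []) (c, []) := by
  refine .through t j k c _ _ hc ?_
  have hk : (k : ℕ) = 0 := by have := k.2; simp [top_eq_of_bot_eq_xax hb] at this; omega
  rw [hj, hk, hb, top_eq_of_bot_eq_xax hb]
  exact .assemble_root

theorem step_assemble (hb : D.bot t = [.x, .a, .x]) (hc : D.wire c = .inr ⟨t, k⟩)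
    (hj : (j : ℕ) ≠ 1) (s : List Bool) :
    D.Step (.inr ⟨t, j⟩, s) (c, decide ((j : ℕ) = 2) :: s) := by
  refine .through t j k c _ _ hc ?_
  have hk : (k : ℕ) = 0 := by have := k.2; simp [top_eq_of_bot_eq_xax hb] at this; omega
  rw [hk, top_eq_of_bot_eq_xax hb]
  rcases outer_cases hb hj with hj | hj <;> rw [hj, hb]
  exacts [.assemble_left s, .assemble_right s]

theorem step_dissect_root (hb : D.bot t = [.x]) (hc : D.wire c = .inr ⟨t, k⟩)
    (hk : (k : ℕ) = 1) : D.Step (.inr ⟨t, j⟩, []) (c, []) := by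
  refine .through t j k c _ _ hc ?_
  have hj : (j : ℕ) = 0 := by have := j.2; simp [hb] at this; omega
  rw [hj, hk, hb, top_eq_of_bot_eq_x hb]
  exact .dissect_root

theorem step_dissect (hb : D.bot t = [.x]) (hc : D.wire c = .inr ⟨t, k⟩)
    (hk : (k : ℕ) ≠ 1) (s : List Bool) :
    D.Step (.inr ⟨t, j⟩, decide ((k : ℕ) = 2) :: s) (c, s) := by
  refine .through t j k c _ _ hc ?_
  have hj : (j : ℕ) = 0 := by have := j.2; simp [hb] at this; omega
  rw [hj, hb]
  rcases outer_cases (top_eq_of_bot_eq_x hb) hk with hk | hk <;>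
    rw [hk, top_eq_of_bot_eq_x hb]
  exacts [.dissect_left s, .dissect_right s]

end steps

theorem bot_length_pos (t : D.T) : 0 < (D.bot t).length := by
  rcases D.bot_cases t with h | h <;> simp [h]

/-- The vertex that is the root of a tree dissected or assembled by the transistor `t`. -/
noncomputable def name (D : BraidedDiagram treePresentation [.x] [.x]) (t : D.T) : List Bool :=
  D.perm.symm (D.endOf
    (.inr ⟨t, ⟨(D.bot t).length / 2, Nat.div_lt_self (bot_length_pos t) one_lt_two⟩⟩, []))

/-- The index `length / 2` in `name` is `0` for the label `x` and `1` for `xax`: in both cases it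
selects the bottom contact that carries the root. -/
theorem endOf_branch {t : D.T} (hb : D.bot t = [.x]) (j : Fin (D.bot t).length) :
    D.endOf (.inr ⟨t, j⟩, []) = D.perm (D.name t) := by
  rw [name, Equiv.apply_symm_apply]
  congr 2
  have := j.2
  simp only [hb, List.length_cons, List.length_nil] at this
  exact inr_mk_eq.2 ⟨rfl, by simp [hb]; omega⟩

theorem endOf_middle {t : D.T} (hb : D.bot t = [.x, .a, .x]) {j : Fin (D.bot t).length}
    (hj : (j : ℕ) = 1) : D.endOf (.inr ⟨t, j⟩, []) = D.perm (D.name t) := by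
  rw [name, Equiv.apply_symm_apply]
  congr 2
  exact inr_mk_eq.2 ⟨rfl, by simp [hb]; omega⟩

theorem endOf_top_middle {t : D.T} (hb : D.bot t = [.x]) {c : Contacts [.x] D.bot}
    {k : Fin (D.top t).length} (hc : D.wire c = .inr ⟨t, k⟩) (hk : (k : ℕ) = 1) :
    D.endOf (c, []) = D.perm (D.name t) := by
  rw [← endOf_branch hb ⟨0, bot_length_pos t⟩]
  exact (step_dissect_root hb hc hk).endOf_eq.symm

theorem endOf_top_branch {t : D.T} (hb : D.bot t = [.x, .a, .x]) {c : Contacts [.x] D.bot}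
    {k : Fin (D.top t).length} (hc : D.wire c = .inr ⟨t, k⟩) :
    D.endOf (c, []) = D.perm (D.name t) := by
  rw [← endOf_middle hb (j := ⟨1, by simp [hb]⟩) rfl]
  exact (step_assemble_root hb hc rfl).endOf_eq.symm

/-- The place of the upper end of a wire. -/
noncomputable def upperPlace (D : BraidedDiagram treePresentation [.x] [.x])
    (c : Contacts [.x] D.bot) : Place := place D.perm D.bot D.name c

/-- The place of the lower end of a wire. -/
noncomputable def lowerPlace (D : BraidedDiagram treePresentation [.x] [.x])
    (c : Contacts [.x] D.bot) : Place := place 1 D.top D.name (D.wire c)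

theorem letter_upperPlace (c : Contacts [.x] D.bot) :
    (D.upperPlace c).letter = contactLabel [.x] D.bot c :=
  letter_place D.bot_cases c

theorem letter_lowerPlace (c : Contacts [.x] D.bot) :
    (D.lowerPlace c).letter = contactLabel [.x] D.bot c :=
  (letter_place D.top_cases _).trans (D.wire_label c)

theorem eq_of_place_eq_branch {T : Type} {g : Equiv.Perm (List Bool)} {lab : T → List TreeLetter}
    {key : T → List Bool} {c : Contacts [.x] lab} {v : List Bool}
    (hlab : ∀ t, lab t = [.x] ∨ lab t = [.x, .a, .x]) (h : place g lab key c = .branch v) :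
    ∃ t j, c = .inr ⟨t, j⟩ ∧ lab t = [.x] ∧ key t = v := by
  rcases contacts_cases hlab c with rfl | ⟨t, j, rfl, ⟨ht, hj⟩ | ⟨ht, hj | hj | hj⟩⟩ <;>
    simp [place, *] at h
  exact ⟨t, j, rfl, ht, h⟩

theorem eq_of_place_eq_middle {T : Type} {g : Equiv.Perm (List Bool)} {lab : T → List TreeLetter}
    {key : T → List Bool} {c : Contacts [.x] lab} {v : List Bool}
    (hlab : ∀ t, lab t = [.x] ∨ lab t = [.x, .a, .x]) (h : place g lab key c = .middle v) :
    ∃ t j, c = .inr ⟨t, j⟩ ∧ lab t = [.x, .a, .x] ∧ (j : ℕ) = 1 ∧ key t = v := by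
  rcases contacts_cases hlab c with rfl | ⟨t, j, rfl, ⟨ht, hj⟩ | ⟨ht, hj | hj | hj⟩⟩ <;>
    simp [place, *] at h
  exact ⟨t, j, rfl, ht, hj, h⟩

theorem endOf_of_upperPlace_eq_branch {c : Contacts [.x] D.bot} {v : List Bool}
    (h : D.upperPlace c = .branch v) : D.endOf (c, []) = D.perm v := by
  obtain ⟨t, j, rfl, ht, rfl⟩ := eq_of_place_eq_branch D.bot_cases h
  exact endOf_branch ht j

theorem endOf_of_upperPlace_eq_middle {c : Contacts [.x] D.bot} {v : List Bool}
    (h : D.upperPlace c = .middle v) : D.endOf (c, []) = D.perm v := by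
  obtain ⟨t, j, rfl, ht, hj, rfl⟩ := eq_of_place_eq_middle D.bot_cases h
  exact endOf_middle ht hj

theorem endOf_of_lowerPlace_eq_branch {c : Contacts [.x] D.bot} {v : List Bool}
    (h : D.lowerPlace c = .branch v) : D.endOf (c, []) = D.perm v := by
  obtain ⟨t, j, hc, ht, rfl⟩ := eq_of_place_eq_branch D.top_cases h
  exact endOf_top_branch (bot_eq_of_top_eq_x ht) hc

theorem endOf_of_lowerPlace_eq_middle {c : Contacts [.x] D.bot} {v : List Bool}
    (h : D.lowerPlace c = .middle v) : D.endOf (c, []) = D.perm v := by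
  obtain ⟨t, j, hc, ht, hj, rfl⟩ := eq_of_place_eq_middle D.top_cases h
  exact endOf_top_middle (bot_eq_of_top_eq_xax ht) hc hj

namespace IsReduced

variable (hD : D.IsReduced)
include hD

/-- Such a wire would be the only one on both sides it joins, so `t'` and `t` would form a dipole.
-/
theorem not_branch_branch {t t' : D.T} (ht : D.bot t = [.x]) (ht' : D.top t' = [.x])
    (j : Fin (D.bot t).length) (k : Fin (D.top t').length) :
    D.wire (.inr ⟨t, j⟩) ≠ .inr ⟨t', k⟩ := by
  intro h
  refine hD t' t ⟨by rw [ht, ht'], fun i => ?_, ?_⟩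
  · have h₁ := j.2
    have h₂ := k.2
    have h₃ := i.2
    simp only [ht, ht', List.length_cons, List.length_nil] at h₁ h₂ h₃
    refine (congrArg D.wire (inr_congr ?_)).trans (h.trans (inr_congr ?_))
    · change (i : ℕ) = j
      omega
    · omega
  · rw [top_eq_of_bot_eq_x ht, bot_eq_of_top_eq_x ht']

theorem exists_upperPlace_eq_node {t : D.T} (ht : D.top t = [.x]) {c : Contacts [.x] D.bot}
    {k : Fin (D.top t).length} (hc : D.wire c = .inr ⟨t, k⟩) : ∃ v, D.upperPlace c = .node v := by
  have h := (letter_upperPlace c).trans (letter_lowerPlace c).symm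
  rw [lowerPlace, hc, place_branch ht] at h
  rcases hp : D.upperPlace c with v | v | v
  · obtain ⟨t', j, rfl, ht', -⟩ := eq_of_place_eq_branch D.bot_cases hp
    exact absurd hc (hD.not_branch_branch ht' ht j k)
  · rw [hp] at h; cases h
  · exact ⟨v, rfl⟩

theorem exists_lowerPlace_eq_node {t : D.T} (ht : D.bot t = [.x]) (j : Fin (D.bot t).length) :
    ∃ v, D.lowerPlace (.inr ⟨t, j⟩) = .node v := by
  have h := (letter_upperPlace (.inr ⟨t, j⟩)).trans (letter_lowerPlace _).symm
  rw [upperPlace, place_branch ht] at h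
  rcases hp : D.lowerPlace (.inr ⟨t, j⟩) with v | v | v
  · obtain ⟨t', k, hw, ht', -⟩ := eq_of_place_eq_branch D.top_cases hp
    exact absurd hw (hD.not_branch_branch ht ht' j k)
  · rw [hp] at h; cases h
  · exact ⟨v, rfl⟩

/-- Induction upwards: by `exists_upperPlace_eq_node` the wire above a positive transistor starts at
the frame or at an outer contact of another positive one, so only assembling happens on the way to
the top. -/
theorem endOf_of_upperPlace_eq_node (c : Contacts [.x] D.bot) :
    ∀ v s, D.upperPlace c = .node v → D.endOf (c, s) = D.perm v ++ s := by
  induction c using D.wellFounded_above.induction with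
  | _ c ih =>
    intro v s hv
    rcases contacts_cases D.bot_cases c with rfl | ⟨t, j, rfl, ⟨ht, hj⟩ | ⟨ht, hj⟩⟩
    · obtain rfl := Place.node.inj hv
      rw [endOf_inl, Equiv.apply_symm_apply, List.nil_append]
    · rw [upperPlace, place_branch ht] at hv; cases hv
    · by_cases hj : (j : ℕ) = 1
      · rw [upperPlace, place_middle ht hj] at hv; cases hv
      rw [upperPlace, place_outer ht hj] at hv
      obtain rfl := Place.node.inj hv
      have hl : 0 < (D.top t).length := by simp [top_eq_of_bot_eq_xax ht]
      have hc := D.wire.apply_symm_apply (.inr ⟨t, ⟨0, hl⟩⟩)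
      obtain ⟨v, hv⟩ := hD.exists_upperPlace_eq_node (top_eq_of_bot_eq_xax ht) hc
      have ih := fun s => ih _ ⟨t, j, _, rfl, hc⟩ v s hv
      have hn := (endOf_top_branch ht hc).symm.trans (ih [])
      rw [(step_assemble ht hc hj s).endOf_eq, ih, hn, Equiv.apply_symm_apply]
      simp

/-- The dual induction downwards: below such a wire there are only negative transistors, down to the
bottom of the frame. -/
theorem endOf_of_lowerPlace_eq_node (c : Contacts [.x] D.bot) :
    ∀ v s, D.lowerPlace c = .node v → D.endOf (c, s) = D.perm (v ++ s) := by
  induction c using D.wellFounded_below.induction with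
  | _ c ih =>
    intro v s hv
    rcases contacts_cases D.top_cases (D.wire c) with hc | ⟨t, k, hc, ⟨ht, hk⟩ | ⟨ht, hk⟩⟩
    · rw [lowerPlace, hc] at hv
      obtain rfl := Place.node.inj hv
      rw [← D.wire.eq_symm_apply] at hc
      rw [hc]
      rfl
    · rw [lowerPlace, hc, place_branch ht] at hv; cases hv
    · by_cases hk : (k : ℕ) = 1
      · rw [lowerPlace, hc, place_middle ht hk] at hv; cases hv
      rw [lowerPlace, hc, place_outer ht hk] at hv
      obtain rfl := Place.node.inj hv
      have hb := bot_eq_of_top_eq_xax ht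
      obtain ⟨v, hv⟩ := hD.exists_lowerPlace_eq_node hb ⟨0, bot_length_pos t⟩
      have ih := fun s => ih _ ⟨t, _, _, rfl, hc⟩ v s hv
      have hn := (endOf_branch hb ⟨0, bot_length_pos t⟩).symm.trans (ih [])
      rw [← (step_dissect hb hc hk s).endOf_eq, ih]
      have hn := D.perm.injective hn
      rw [List.append_nil] at hn
      rw [hn, one_symm_apply]
      simp

theorem node_of_step {p q : Contacts [.x] D.bot × List Bool} {v : List Bool} (h : D.Step p q)
    (hp : D.upperPlace p.1 = .node v) :
    (∃ w, D.upperPlace q.1 = .node w) ∧ q.2.length = p.2.length + 1 := by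
  obtain ⟨t, j, k, hp', hq, ⟨hb, -⟩ | ⟨hb, ht, h⟩⟩ := h.label_cases
  · rw [hp', upperPlace, place_branch hb] at hp; cases hp
  · refine ⟨hD.exists_upperPlace_eq_node ht hq, ?_⟩
    obtain ⟨-, hj, -⟩ | ⟨hs, -⟩ | ⟨hs, -⟩ := h
    · rw [hp', upperPlace, place_middle hb hj] at hp; cases hp
    · simp [hs]
    · simp [hs]

theorem eq_of_reflTransGen_of_node {p q : Contacts [.x] D.bot × List Bool} {v : List Bool}
    (h : Relation.ReflTransGen D.Step p q) (hp : D.upperPlace p.1 = .node v)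
    (hq : q.2.length ≤ p.2.length) : p = q := by
  have key : (∃ w, D.upperPlace q.1 = .node w) ∧ (p = q ∨ p.2.length < q.2.length) := by
    clear hq
    induction h with
    | refl => exact ⟨⟨v, hp⟩, .inl rfl⟩
    | tail _ h ih =>
      obtain ⟨⟨w, hw⟩, ih⟩ := ih
      obtain ⟨hn, hl⟩ := hD.node_of_step h hw
      refine ⟨hn, .inr ?_⟩
      obtain rfl | ih := ih <;> omega
  exact key.2.resolve_right (by omega)

/-- The roots of the two trees lie on a common path. Each assembling step on it lengthens the
sequence, so a path between two empty sequences is trivial. -/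
theorem eq_of_endOf_eq {c c' : Contacts [.x] D.bot} {v v' : List Bool}
    (hc : D.upperPlace c = .node v) (hc' : D.upperPlace c' = .node v')
    (h : D.endOf (c, []) = D.endOf (c', [])) : c = c' := by
  rcases reflTransGen_total_of_endOf_eq (isVertex_nil c) (isVertex_nil c') h with h | h
  · exact (Prod.ext_iff.1 (hD.eq_of_reflTransGen_of_node h hc le_rfl)).1
  · exact (Prod.ext_iff.1 (hD.eq_of_reflTransGen_of_node h hc' le_rfl)).1.symm

omit hD in
theorem _root_.BraidedDiagram.exists_middle_of_label {c : Contacts [.x] D.bot}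
    (h : contactLabel [.x] D.bot c = .a) : ∃ (t t' : D.T) (j : Fin (D.bot t).length) (k : Fin (D.top t').length),
      c = .inr ⟨t, j⟩ ∧ D.wire c = .inr ⟨t', k⟩ ∧
      D.bot t = [.x, .a, .x] ∧ D.bot t' = [.x] ∧ (j : ℕ) = 1 ∧ (k : ℕ) = 1 ∧
      D.endOf (c, []) = D.perm (D.name t) ∧ D.name t = D.name t' := by
  have h₁ := (letter_upperPlace c).trans h
  have h₂ := (letter_lowerPlace c).trans h
  rcases hp : D.upperPlace c with v | v | v <;> rw [hp] at h₁ <;> try cases h₁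
  rcases hp' : D.lowerPlace c with w | w | w <;> rw [hp'] at h₂ <;> try cases h₂
  have e := (endOf_of_upperPlace_eq_middle hp).symm.trans (endOf_of_lowerPlace_eq_middle hp')
  obtain ⟨t, j, rfl, ht, hj, rfl⟩ := eq_of_place_eq_middle D.bot_cases hp
  obtain ⟨t', k, hc', ht', hk, rfl⟩ := eq_of_place_eq_middle D.top_cases hp'
  exact ⟨t, t', j, k, rfl, hc', ht, bot_eq_of_top_eq_xax ht', hj, hk, endOf_middle ht hj,
    D.perm.injective e⟩

omit hD in
theorem _root_.BraidedDiagram.exists_bot_middle {t : D.T} (ht : D.bot t = [.x, .a, .x]) :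
    ∃ (t' : D.T) (j : Fin (D.bot t).length) (k : Fin (D.top t').length), D.bot t' = [.x] ∧ (j : ℕ) = 1 ∧ (k : ℕ) = 1 ∧ D.name t = D.name t' ∧
      D.wire (.inr ⟨t, j⟩) = .inr ⟨t', k⟩ := by
  have hl : 1 < (D.bot t).length := by simp [ht]
  obtain ⟨s, t', j, k, e, hw, -, ht', hj, hk, -, hn⟩ := exists_middle_of_label
    (c := .inr ⟨t, ⟨1, hl⟩⟩) (Option.some.inj ((some_contactLabel_inr ..).trans (by simp [ht])))
  cases Sum.inr.inj e
  exact ⟨t', _, k, ht', hj, hk, hn, hw⟩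

omit hD in
theorem _root_.BraidedDiagram.exists_top_middle {t' : D.T} (ht' : D.bot t' = [.x]) :
    ∃ (t : D.T) (j : Fin (D.bot t).length) (k : Fin (D.top t').length), D.bot t = [.x, .a, .x] ∧ (j : ℕ) = 1 ∧ (k : ℕ) = 1 ∧ D.name t = D.name t' ∧
      D.wire (.inr ⟨t, j⟩) = .inr ⟨t', k⟩ := by
  have hl : 1 < (D.top t').length := by simp [top_eq_of_bot_eq_x ht']
  have hc := D.wire.apply_symm_apply (.inr ⟨t', ⟨1, hl⟩⟩)
  obtain ⟨t, s, j, k, e, hw, ht, -, hj, hk, -, hn⟩ := exists_middle_of_label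
    (Option.some.inj ((contactLabel_eq_of_wire hc).trans (by simp [top_eq_of_bot_eq_x ht'])))
  cases Sum.inr.inj (hc.symm.trans hw)
  rw [e] at hc
  exact ⟨t, j, _, ht, hj, hk, hn, hc⟩

/-- If `D.perm` translated the subtree at the name of `t`, then `t` and the positive transistor `t'`
above its `a`-wire would form a dipole. The induction goes upwards through the negative transistors.
-/
theorem name_mem_of_branch (c : Contacts [.x] D.bot) : ∀ t j, c = .inr ⟨t, j⟩ → D.bot t = [.x] →
    D.name t ∈ properDomain D.perm := by
  induction c using D.wellFounded_above.induction with
  | _ c ih =>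
    rintro t j rfl ht
    by_contra hn
    have happ := apply_append_of_notMem_properDomain hn
    have htop := top_eq_of_bot_eq_x ht
    obtain ⟨t', j', k', ht', hj', hk', hname, hw'⟩ := exists_top_middle ht
    have outer : ∀ (k : Fin (D.top t).length) (i : Fin (D.bot t').length), (k : ℕ) = i →
        (k : ℕ) ≠ 1 → D.wire (.inr ⟨t', i⟩) = .inr ⟨t, k⟩ := by
      intro k i hki hk
      have hc := D.wire.apply_symm_apply (.inr ⟨t, k⟩)
      set c := D.wire.symm (.inr ⟨t, k⟩)
      have hlow : D.lowerPlace c = .node (D.name t ++ [decide ((k : ℕ) = 2)]) := by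
        rw [lowerPlace, hc, place_outer htop hk]; rfl
      have hend := hD.endOf_of_lowerPlace_eq_node c _ [] hlow
      rw [List.append_nil] at hend
      have hlet := (letter_upperPlace c).trans (letter_lowerPlace c).symm
      rw [hlow] at hlet
      rcases hp : D.upperPlace c with v | v | v
      -- A negative transistor directly above would be named by a child of `D.name t`. By induction
      -- that child is in the proper domain, hence so is its prefix `D.name t`.
      · have e := D.perm.injective ((endOf_of_upperPlace_eq_branch hp).symm.trans hend)
        obtain ⟨s, l, hcs, hs, hv⟩ := eq_of_place_eq_branch D.bot_cases hp
        have := ih c ⟨t, j, k, rfl, hc⟩ s l hcs hs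
        rw [hv, e] at this
        exact absurd (mem_properDomain_of_append this) hn
      · rw [hp] at hlet; cases hlet
      · rw [← hc]
        congr 1
        -- Otherwise the wire carries the subtree of the image tree at a child of `D.perm (D.name
        -- t)`, as does the wire at contact `i` of `t'`; so the two coincide.
        have hi : (i : ℕ) ≠ 1 := hki ▸ hk
        have hup : D.upperPlace (.inr ⟨t', i⟩) = .node _ := place_outer ht' hi
        refine hD.eq_of_endOf_eq hup hp ?_
        rw [hend, hD.endOf_of_upperPlace_eq_node _ _ [] hup, Equiv.apply_symm_apply, happ, hname,
          List.append_nil, hki]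
    refine hD t t' ⟨by rw [htop, ht'], fun i => ?_, by rw [ht, top_eq_of_bot_eq_xax ht']⟩
    by_cases hi : (i : ℕ) = 1
    · refine (congrArg D.wire (inr_congr ?_)).trans (hw'.trans (inr_congr ?_))
      · exact hi.trans hj'.symm
      · exact hk'.trans hi.symm
    · exact outer i _ rfl hi

theorem name_mem (t : D.T) : D.name t ∈ properDomain D.perm := by
  rcases D.bot_cases t with ht | ht
  · exact hD.name_mem_of_branch _ t ⟨0, bot_length_pos t⟩ rfl ht
  · obtain ⟨t', -, -, ht', -, -, hn, -⟩ := exists_bot_middle ht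
    rw [hn]
    exact hD.name_mem_of_branch _ t' ⟨0, bot_length_pos t'⟩ rfl ht'

theorem name_inj_of_assemble {t t' : D.T} (ht : D.bot t = [.x, .a, .x])
    (ht' : D.bot t' = [.x, .a, .x]) (h : D.name t = D.name t') : t = t' := by
  have hl : 0 < (D.top t).length := by simp [top_eq_of_bot_eq_xax ht]
  have hl' : 0 < (D.top t').length := by simp [top_eq_of_bot_eq_xax ht']
  have hc := D.wire.apply_symm_apply (.inr ⟨t, ⟨0, hl⟩⟩)
  have hc' := D.wire.apply_symm_apply (.inr ⟨t', ⟨0, hl'⟩⟩)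
  obtain ⟨v, hv⟩ := hD.exists_upperPlace_eq_node (top_eq_of_bot_eq_xax ht) hc
  obtain ⟨v', hv'⟩ := hD.exists_upperPlace_eq_node (top_eq_of_bot_eq_xax ht') hc'
  have := hD.eq_of_endOf_eq hv hv' (by rw [endOf_top_branch ht hc, endOf_top_branch ht' hc', h])
  exact (inr_mk_eq.1 (D.wire.symm.injective this)).1

/-- The `a`-wires pair negative with positive transistors of the same name, which reduces the
negative case to the positive one. -/
theorem name_inj {t t' : D.T} (hb : D.bot t = D.bot t') (h : D.name t = D.name t') : t = t' := by
  rcases D.bot_cases t with ht | ht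
  · obtain ⟨s, j, k, hs, hj, hk, hn, hw⟩ := exists_top_middle ht
    obtain ⟨s', j', k', hs', hj', hk', hn', hw'⟩ := exists_top_middle (hb ▸ ht)
    obtain rfl := hD.name_inj_of_assemble hs hs' (hn.trans (h.trans hn'.symm))
    obtain rfl := Fin.ext (hj.trans hj'.symm)
    exact (inr_mk_eq.1 (hw.symm.trans hw')).1
  · exact hD.name_inj_of_assemble ht (hb ▸ ht) h

theorem isNormal : D.IsNormal D.perm D.name := by
  have hsurj : ∀ v ∈ properDomain D.perm, ∃ t t', D.bot t = [.x, .a, .x] ∧ D.bot t' = [.x] ∧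
      D.name t = v ∧ D.name t' = v := by
    intro v hv
    obtain ⟨c, hc, he⟩ := exists_label_a_of_mem_properDomain hv
    obtain ⟨t, t', j, k, -, -, ht, ht', -, -, hn, hn'⟩ := exists_middle_of_label hc
    have := D.perm.injective (hn.symm.trans he)
    exact ⟨t, t', ht, ht', this, hn' ▸ this⟩
  refine ⟨⟨D.bot_cases, fun _ _ => hD.name_inj, hD.name_mem, fun v hv => ?_⟩,
    ⟨D.top_cases, fun t t' h => hD.name_inj ?_, hD.name_mem, fun v hv => ?_⟩, fun c => ?_⟩
  · obtain ⟨t, t', ht, ht', hn, hn'⟩ := hsurj v hv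
    exact ⟨⟨t', ht', hn'⟩, t, ht, hn⟩
  · rcases D.label_cases t with ⟨h₁, h₂⟩ | ⟨h₁, h₂⟩ <;>
    rcases D.label_cases t' with ⟨h₃, h₄⟩ | ⟨h₃, h₄⟩ <;> simp_all
  · obtain ⟨t, t', ht, ht', hn, hn'⟩ := hsurj v hv
    exact ⟨⟨t, top_eq_of_bot_eq_xax ht, hn⟩, t', top_eq_of_bot_eq_x ht', hn'⟩
  · change D.lowerPlace c = (D.upperPlace c).swap _
    have hlet := (letter_upperPlace c).trans (letter_lowerPlace c).symm
    rcases hu : D.upperPlace c with v | v | v <;> rcases hl : D.lowerPlace c with w | w | w <;>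
      rw [hu, hl] at hlet <;> try cases hlet
    · obtain ⟨t, j, rfl, ht, -⟩ := eq_of_place_eq_branch D.bot_cases hu
      obtain ⟨w', hw'⟩ := hD.exists_lowerPlace_eq_node ht j
      rw [hl] at hw'; cases hw'
    · have e := (endOf_of_upperPlace_eq_branch hu).symm.trans
        (hD.endOf_of_lowerPlace_eq_node c w [] hl)
      rw [List.append_nil] at e
      obtain ⟨t, j, -, -, rfl⟩ := eq_of_place_eq_branch D.bot_cases hu
      rw [Place.swap_branch (hD.name_mem t), D.perm.injective e]
    · rw [D.perm.injective ((endOf_of_upperPlace_eq_middle hu).symm.trans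
        (endOf_of_lowerPlace_eq_middle hl))]
      rfl
    · have e := (hD.endOf_of_upperPlace_eq_node c v [] hu).symm.trans
        (endOf_of_lowerPlace_eq_branch hl)
      rw [List.append_nil] at e
      obtain ⟨t, j, -, -, rfl⟩ := eq_of_place_eq_branch D.top_cases hl
      rw [D.perm.injective e, Place.swap, if_pos (hD.name_mem t)]
    · have hup := fun s => hD.endOf_of_upperPlace_eq_node c v s hu
      have hlo := fun s => hD.endOf_of_lowerPlace_eq_node c w s hl
      have e := (hup []).symm.trans (hlo [])
      rw [List.append_nil, List.append_nil] at e
      obtain rfl := D.perm.injective e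
      -- The wire carries at once the full subtree at `v` of the source tree and the one at `D.perm
      -- v` of the image tree, so `D.perm` translates at `v` and the swap leaves `node v` fixed.
      rw [Place.swap, if_neg (notMem_properDomain.2 fun s => (hlo s).symm.trans (hup s))]

end IsReduced

theorem dipoleSetoid_of_perm_eq {D D' : BraidedDiagram treePresentation [.x] [.x]}
    (h : D.perm = D'.perm) : dipoleSetoid treePresentation [.x] [.x] D D' := by
  obtain ⟨E, hE, hDE⟩ := D.exists_isReduced
  obtain ⟨E', hE', hDE'⟩ := D'.exists_isReduced
  have hn := hE.isNormal
  rw [← perm_eq_of_dipoleSetoid hDE, h, perm_eq_of_dipoleSetoid hDE'] at hn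
  exact Setoid.trans' _ hDE
    (Setoid.trans' _ (.rel _ _ (.inl (hn.iso hE'.isNormal))) (Setoid.symm' _ hDE'))

end BraidedDiagram

/-! ### The isomorphism with `QV` -/

theorem mainTheorem4 :
    ∃ e : BraidedDiagramGroup treePresentation [TreeLetter.x] ≃* QV,
      ∀ D : BraidedDiagram treePresentation [TreeLetter.x] [TreeLetter.x],
        D.Encodes (e (BraidedDiagramGroup.mk D) : Equiv.Perm (List Bool)) := by
  let φ : BraidedDiagramGroup treePresentation [TreeLetter.x] → QV :=
    Quotient.lift (fun D => ⟨D.perm, D.perm_mem_QV⟩)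
      fun _ _ h => Subtype.ext (BraidedDiagram.perm_eq_of_dipoleSetoid h)
  have hφ : Function.Bijective φ := by
    constructor
    · rintro ⟨D⟩ ⟨E⟩ h
      exact Quotient.sound (BraidedDiagram.dipoleSetoid_of_perm_eq (congrArg Subtype.val h))
    · intro h
      obtain ⟨D, key, hD⟩ := BraidedDiagram.exists_isNormal (finite_properDomain h.2)
      exact ⟨BraidedDiagramGroup.mk D, Subtype.ext hD.perm_eq⟩
  refine ⟨MulEquiv.mk (Equiv.ofBijective φ hφ) fun a b => ?_, fun D => BraidedDiagram.encodes_perm⟩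
  exact Quotient.inductionOn₂ a b fun D E => Subtype.ext BraidedDiagram.perm_concat
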